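/- **Notation.** For $k\ge 1$ let $L_0,\dots,L_k$ be the Lagrange polynomials for the knots $t_j=j/k$, $j=0,\dots,k$, and $\langle u,v\rangle=\int_0^1uv$. Let $K_0,K_1$ be the real $k\times k$ matrices with $(K_0)_{ij}=\langle L_j',L_i'\rangle$ for $(i,j)\ne(k,k)$, $(K_0)_{kk}=\langle L_k',L_k'\rangle+\langle L_0',L_0'\rangle$, $(K_1)_{ik}=\langle L_0',L_i'\rangle$ and $(K_1)_{ij}=0$ for $j<k$, and let $M_0,M_1$ be defined in the same way without the derivatives. Put $\mathbf f_k(\theta)=K_0+K_1e^{\hat\imath\theta}+K_1^Te^{-\hat\imath\theta}$ and $\mathbf h_k(\theta)=M_0+M_1e^{\hat\imath\theta}+M_1^Te^{-\hat\imath\theta}$. For $d\ge1$ and $\boldsymbol\theta\in[-\pi,\pi]^d$ the symbol of the $\mathbb Q_k$ Lagrangian finite elements is $$\mathbf f_{\mathbb Q_k}(\boldsymbol\theta)=\sum_{r=1}^d \mathbf h_k(\theta_1)\otimes\cdots\otimes\mathbf h_k(\theta_{r-1})\otimes\mathbf f_k(\theta_r)\otimes\mathbf h_k(\theta_{r+1})\otimes\cdots\otimes\mathbf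 h_k(\theta_d)\in\mathbb C^{k^d\times k^d}.$$ For $d=2$, with $x=e^{\hat\imath\theta_1}$, $y=e^{\hat\imath\theta_2}$, the symbols of the $\mathbb P_2$ and $\mathbb P_3$ Lagrangian finite elements on Friedrichs–Keller triangulations are the following matrices. With $\alpha=\frac{16}3$, $\beta=\frac43$, $$\mathbf f_{\mathbb P_2}=\begin{bmatrix}\alpha&-\beta(1+x)&-\beta(1+y)&0\\-\beta(1+\bar x)&\alpha&0&-\beta(1+y)\\-\beta(1+\bar y)&0&\alpha&-\beta(1+x)\\0&-\beta(1+\bar y)&-\beta(1+\bar x)&4+\frac\beta2(\cos\theta_1+\cos\theta_2)\end{bmatrix}.$$ With $\alpha=\frac{81}{10}$, $\beta=\frac{27}4$, $\gamma=\frac3{40}$, $\delta=\frac{57}{80}$, $\varepsilon=\frac{21}{16}$, the matrix $\mathbf f_{\mathbb P_3}(\boldsymbol\theta)\in\mathbb C^{9\times 9}$ is the Hermitian matrix whose entries on and above the diagonal are zero except for - $f_{11}=f_{55}=\alpha$, $f_{22}=f_{33}=f_{44}=f_{66}=f_{77}=f_{88}=\beta$, $f_{99}=\frac{17}5-\frac7{20}(\cos\theta_1+\cos\theta_2)$;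 - $f_{12}=f_{14}=f_{25}=f_{45}=f_{56}=f_{58}=-\frac\alpha4$, $f_{13}=-\frac\alpha4x$, $f_{17}=-\frac\alpha4y$, $f_{24}=-\frac\beta5$, $f_{36}=f_{78}=-\frac\beta2$; - $f_{23}=-\frac\beta4+\frac\beta{20}x$, $f_{47}=-\frac\beta4+\frac\beta{20}y$, $f_{28}=\frac\beta{20}-\frac\beta4y$, $f_{46}=\frac\beta{20}-\frac\beta4x$, $f_{26}=\frac\beta{20}(1+x)$, $f_{27}=f_{48}=\frac\beta{20}(1+y)$, $f_{34}=\frac\beta{20}(1+\bar x)$; - $f_{29}=f_{49}=-\gamma(1-x)(1-y)$, $f_{39}=\delta-\frac\gamma2x-\varepsilon y-\frac\gamma2\bar xy$, $f_{69}=-\varepsilon-\frac\gamma2x+\delta y-\frac\gamma2\bar xy$, $f_{79}=\delta-\varepsilon x-\frac\gamma2x\bar y-\frac\gamma2y$, $f_{89}=-\varepsilon+\delta x-\frac\gamma2x\bar y-\frac\gamma2y$. **Theorem.** Let $\mathbf f$ be $\mathbf f_{\mathbb Q_k}$ in dimension $d$, for any $k,d\ge1$, or $\mathbf f_{\mathbb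 P_k}$ with $k\in\{2,3\}$ in dimension $d=2$. Then $\mathbf f(\boldsymbol\theta)$ is a Hermitian $k^d\times k^d$ matrix, and with its eigenvalues ordered as $\lambda_1(\mathbf f(\boldsymbol\theta))\le\cdots\le\lambda_{k^d}(\mathbf f(\boldsymbol\theta))$ the following holds. 1. $\mathbf f(\mathbf 0)\mathbf e=\mathbf 0$, where $\mathbf e$ is the vector of all ones. 2. There are constants $C_1,C_2>0$, depending only on $\mathbf f$, such that for all $\boldsymbol\theta\in[-\pi,\pi]^d$ $$C_1\sum_{j=1}^d(2-2\cos\theta_j)\le\lambda_1(\mathbf f(\boldsymbol\theta))\le C_2\sum_{j=1}^d(2-2\cos\theta_j).$$ 3. There are constants $m,M>0$, depending only on $\mathbf f$, such that $m\le\lambda_j(\mathbf f(\boldsymbol\theta))\le M$ for all $\boldsymbol\theta\in[-\pi,\pi]^d$ and $j=2,\dots,k^d$. -/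

import Mathlib

open Polynomial

namespace FEMSymbol

noncomputable section

/-- The `i`-th eigenvalue, `i = 1, …, N`, of a Hermitian `N × N` matrix, counted with multiplicity
and in increasing order: `λ₁ ≤ λ₂ ≤ … ≤ λ_N`. (`eigenvalues₀` lists them in decreasing order. The
value outside `1 ≤ i ≤ N` is a default.) -/
def eig {n : Type} [Fintype n] [DecidableEq n] {A : Matrix n n ℂ} (hA : A.IsHermitian)
    (i : ℕ) : ℝ :=
  if h : 1 ≤ i ∧ i ≤ Fintype.card n then
    hA.eigenvalues₀ ⟨Fintype.card n - i, by omega⟩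
  else 0

/-- The Lagrange polynomials `L₀, …, L_k` for the knots `t_j = j / k`, `j = 0, …, k`. -/
def lagr (k : ℕ) (i : Fin (k + 1)) : ℝ[X] :=
  Lagrange.basis Finset.univ (fun j : Fin (k + 1) => (j : ℝ) / (k : ℝ)) i

/-- The element stiffness entries `⟨L_i', L_j'⟩` in `L²(0,1)`. -/
def stiff (k : ℕ) (i j : Fin (k + 1)) : ℝ :=
  ∫ t in (0 : ℝ)..1, (derivative (lagr k i)).eval t * (derivative (lagr k j)).eval t

/-- The element mass entries `⟨L_i, L_j⟩` in `L²(0,1)`. -/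
def mass (k : ℕ) (i j : Fin (k + 1)) : ℝ :=
  ∫ t in (0 : ℝ)..1, (lagr k i).eval t * (lagr k j).eval t

/-- The diagonal `k × k` block assembled from element entries `E₀₀, …, E_kk`: the entries `E_ij`,
`i, j = 1, …, k`, with `E₀₀` added in the last position, as the last local node of an element is
the local node `0` of the next one. Row and column `i : Fin k` stand for the local node `i + 1`. -/
def blockDiag {k : ℕ} (E : Fin (k + 1) → Fin (k + 1) → ℝ) : Matrix (Fin k) (Fin k) ℝ :=
  Matrix.of fun i j =>
    E j.succ i.succ + if (i : ℕ) + 1 = k ∧ (j : ℕ) + 1 = k then E 0 0 else 0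

/-- The subdiagonal `k × k` block assembled from element entries: its last column is
`(E₀₁, …, E₀_k)` and its other columns are zero. -/
def blockSub {k : ℕ} (E : Fin (k + 1) → Fin (k + 1) → ℝ) : Matrix (Fin k) (Fin k) ℝ :=
  Matrix.of fun i j => if (j : ℕ) + 1 = k then E 0 i.succ else 0

/-- The symbol `K₀ + K₁ e^{iθ} + K₁ᵀ e^{-iθ}` of the assembled block tridiagonal matrix. -/
def symbol1D {k : ℕ} (E : Fin (k + 1) → Fin (k + 1) → ℝ) (θ : ℝ) : Matrix (Fin k) (Fin k) ℂ :=
  (blockDiag E).map Complex.ofReal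
    + Complex.exp (θ * Complex.I) • (blockSub E).map Complex.ofReal
    + Complex.exp (-(θ * Complex.I)) • ((blockSub E).map Complex.ofReal).transpose

/-- The symbol `f_{ℚ_k}` in dimension `d`: the sum over `r` of the Kronecker products of the
stiffness symbol in the variable `θ_r` with the mass symbols in the other variables,
`∑ r, h(θ₁) ⊗ ⋯ ⊗ f(θ_r) ⊗ ⋯ ⊗ h(θ_d)`. Its `k ^ d` rows and columns are indexed by the
multi-indices `Fin d → Fin k`. For `d = 1` it is the stiffness symbol. -/
def fQ (k d : ℕ) (θ : Fin d → ℝ) : Matrix (Fin d → Fin k) (Fin d → Fin k) ℂ :=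
  ∑ r : Fin d, Matrix.of fun i j =>
    ∏ s : Fin d,
      (if s = r then symbol1D (stiff k) (θ s) else symbol1D (mass k) (θ s)) (i s) (j s)

/-- The symbol `f_{ℙ₂}` in dimension `2` (with `x = e^{iθ₁}`, `y = e^{iθ₂}`). -/
def fP2 (θ : Fin 2 → ℝ) : Matrix (Fin 4) (Fin 4) ℂ :=
  let x : ℂ := Complex.exp (θ 0 * Complex.I)
  let y : ℂ := Complex.exp (θ 1 * Complex.I)
  let x' : ℂ := Complex.exp (-(θ 0 * Complex.I))
  let y' : ℂ := Complex.exp (-(θ 1 * Complex.I))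
  let a : ℂ := 16 / 3
  let b : ℂ := 4 / 3
  let c : ℂ := 4
  !![a,             -b * (1 + x),  -b * (1 + y),  0;
     -b * (1 + x'), a,             0,             -b * (1 + y);
     -b * (1 + y'), 0,             a,             -b * (1 + x);
     0,             -b * (1 + y'), -b * (1 + x'),
       c + b / 2 * (Real.cos (θ 0) + Real.cos (θ 1) : ℝ)]

/-- The symbol `f_{ℙ₃}` in dimension `2` (with `x = e^{iθ₁}`, `y = e^{iθ₂}`). -/
def fP3 (θ : Fin 2 → ℝ) : Matrix (Fin 9) (Fin 9) ℂ :=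
  let x : ℂ := Complex.exp (θ 0 * Complex.I)
  let y : ℂ := Complex.exp (θ 1 * Complex.I)
  let x' : ℂ := Complex.exp (-(θ 0 * Complex.I))
  let y' : ℂ := Complex.exp (-(θ 1 * Complex.I))
  let a : ℂ := 81 / 10
  let b : ℂ := 27 / 4
  let c : ℂ := 3 / 40
  let δ : ℂ := 57 / 80
  let ε : ℂ := 21 / 16
  let ζ : ℂ := 17 / 5
  let η : ℂ := 7 / 40
  let f29 : ℂ := -c * (1 - x) * (1 - y)
  let f39 : ℂ := δ - c / 2 * x - ε * y - c / 2 * x' * y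
  let f49 : ℂ := -c * (1 - x) * (1 - y)
  let f69 : ℂ := -ε - c / 2 * x + δ * y - c / 2 * x' * y
  let f79 : ℂ := δ - ε * x - c / 2 * x * y' - c / 2 * y
  let f89 : ℂ := -ε + δ * x - c / 2 * x * y' - c / 2 * y
  let f99 : ℂ := ζ - 2 * η * (Real.cos (θ 0) + Real.cos (θ 1) : ℝ)
  !![a, -a/4, -a/4*x,  -a/4, 0, 0,  -a/4*y, 0, 0;
     -a/4, b, -b/4 + b/20*x,  -b/5, -a/4, b/20*(1 + x),
       b/20*(1 + y), b/20 - b/4*y, f29;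
     -a/4*x', -b/4 + b/20*x', b,  b/20*(1 + x'), 0, -b/2,  0, 0, f39;
     -a/4, -b/5, b/20*(1 + x),  b, -a/4, b/20 - b/4*x,
       -b/4 + b/20*y, b/20*(1 + y), f49;
     0, -a/4, 0,  -a/4, a, -a/4,  0, -a/4, 0;
     0, b/20*(1 + x'), -b/2,  b/20 - b/4*x', -a/4, b,  0, 0, f69;
     -a/4*y', b/20*(1 + y'), 0,  -b/4 + b/20*y', 0, 0,  b, -b/2, f79;
     0, b/20 - b/4*y', 0,  b/20*(1 + y'), -a/4, 0,  -b/2, b, f89;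
     0, star f29, star f39,  star f49, 0, star f69,  star f79, star f89, f99]

/-- The three spectral claims about a symbol `f` with `k ^ d` rows and columns on `[-π, π]^d`,
together with the fact that its values are Hermitian, so that the eigenvalues are real. -/
def SpectralClaims (k d : ℕ) {n : Type} [Fintype n] [DecidableEq n]
    (f : (Fin d → ℝ) → Matrix n n ℂ) : Prop :=
  Fintype.card n = k ^ d ∧
  ∃ hf : ∀ θ, (f θ).IsHermitian,
    (f 0).mulVec (fun _ => 1) = 0 ∧
    (∃ C₁ C₂ : ℝ, 0 < C₁ ∧ 0 < C₂ ∧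
      ∀ θ : Fin d → ℝ, (∀ j, θ j ∈ Set.Icc (-Real.pi) Real.pi) →
        C₁ * ∑ j, (2 - 2 * Real.cos (θ j)) ≤ eig (hf θ) 1 ∧
        eig (hf θ) 1 ≤ C₂ * ∑ j, (2 - 2 * Real.cos (θ j))) ∧
    (∃ m M : ℝ, 0 < m ∧ 0 < M ∧
      ∀ θ : Fin d → ℝ, (∀ j, θ j ∈ Set.Icc (-Real.pi) Real.pi) →
        ∀ j : ℕ, 2 ≤ j → j ≤ k ^ d → m ≤ eig (hf θ) j ∧ eig (hf θ) j ≤ M)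

end

end FEMSymbol

/-! The form `v* f(θ) v` is the energy, on one periodicity cell, of the Bloch wave whose nodal
values are `v` times phases `e^{iθ}`. It is therefore a sum of element energies evaluated at
phase-shifted nodal values. Let `o` be a vertex node and `s = ∑ (2 - 2 cos θ_j)`. Everything follows
from comparing nodal values. Small energy forces all entries of `v` to be close to `v o`, so `‖v a -
v o‖² ≤ B₃ v* f v`. It also forces `v o` to be close to its own phase shifts, so `s ‖v o‖² ≤ B₂ v* f
v`. On the hyperplane `v o = 0` the first bound makes `f` coercive, so by Courant–Fischer all
eigenvalues but the smallest stay away from zero. Together the two bounds give `λ₁ ≥ C₁ s`. The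
vector of ones, with energy at most `B₁ s`, gives the upper bound for `λ₁` and the kernel at `θ =
0`. The trace bounds the eigenvalues above. `spectralClaims_of_quad` carries out this reduction. For
`ℙ₂` and `ℙ₃` the cell consists of two triangles, and the bounds come from explicit sum-of-squares
certificates for the element matrix. For `ℚ_k` the 1D stiffness form dominates squared differences
of knot values (`sq_sub_le_stiff`), and the 1D mass form dominates point values
(`exists_norm_sq_le_quad_mass`). Loewner monotonicity of the Kronecker product
(`posSemidef_piKron_sub`) multiplies these bounds over the coordinates. -/

namespace FEMSymbol

open Matrix
open scoped ComplexOrder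

/-! ### Rayleigh quotients and ordered eigenvalues -/

section Rayleigh

variable {n : Type} [Fintype n]

/-- The sesquilinear form `v* A v`. -/
def form (A : Matrix n n ℂ) (v : n → ℂ) : ℂ := star v ⬝ᵥ A *ᵥ v

/-- The real part of the form `v ↦ v* A v`. -/
def quad (A : Matrix n n ℂ) (v : n → ℂ) : ℝ := (form A v).re

theorem form_eq_sum (A : Matrix n n ℂ) (v : n → ℂ) :
    form A v = ∑ i, ∑ j, star (v i) * A i j * v j := by
  simp [form, dotProduct, mulVec, Finset.mul_sum, mul_assoc]

/-- By polarization, a real-valued complex form comes from a self-adjoint operator. Symmetry of a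
symbol can thus be read off from its element decomposition, without comparing entries. -/
theorem isHermitian_of_form_im_eq_zero [DecidableEq n] {A : Matrix n n ℂ}
    (h : ∀ v, (form A v).im = 0) : A.IsHermitian := by
  rw [← isSymmetric_toEuclideanLin_iff, LinearMap.isSymmetric_iff_inner_map_self_real]
  intro v
  rw [inner_conj_symm, ← inner_conj_symm v]
  have h1 : inner ℂ v (toEuclideanLin A v) = form A v := by
    rw [EuclideanSpace.inner_eq_star_dotProduct, dotProduct_comm]
    rfl
  rw [← inner_conj_symm, h1, Complex.conj_conj, eq_comm, Complex.conj_eq_iff_im]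
  exact h v

theorem sum_norm_sq_eq (v : n → ℂ) : ((∑ a, ‖v a‖ ^ 2 : ℝ) : ℂ) = star v ⬝ᵥ v := by
  simp [dotProduct, ← Complex.conj_mul', RCLike.star_def]

variable [DecidableEq n] {A : Matrix n n ℂ} (hA : A.IsHermitian)

theorem quad_eigenvectorUnitary (c : n → ℂ) :
    quad A ((hA.eigenvectorUnitary : Matrix n n ℂ) *ᵥ c) = ∑ i, hA.eigenvalues i * ‖c i‖ ^ 2 := by
  have h := hA.conjStarAlgAut_star_eigenvectorUnitary
  rw [Unitary.conjStarAlgAut_star_apply] at h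
  have h2 : star ((hA.eigenvectorUnitary : Matrix n n ℂ) *ᵥ c) ⬝ᵥ
      (A *ᵥ ((hA.eigenvectorUnitary : Matrix n n ℂ) *ᵥ c)) =
      star c ⬝ᵥ (diagonal (RCLike.ofReal ∘ hA.eigenvalues) *ᵥ c) := by
    rw [← h, star_mulVec, ← mulVec_mulVec, ← mulVec_mulVec, ← dotProduct_mulVec]
    rfl
  rw [quad, form, h2]
  simp only [dotProduct, mulVec_diagonal, Complex.re_sum]
  refine Finset.sum_congr rfl fun i _ => ?_
  have : star c i * ((RCLike.ofReal ∘ hA.eigenvalues) i * c i) =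
      ((hA.eigenvalues i * ‖c i‖ ^ 2 : ℝ) : ℂ) := by
    push_cast
    rw [← Complex.conj_mul']
    simp only [Function.comp, Pi.star_apply, RCLike.star_def, Complex.coe_algebraMap]
    ring
  rw [this, Complex.ofReal_re]

theorem sum_norm_sq_eigenvectorUnitary (c : n → ℂ) :
    ∑ a, ‖((hA.eigenvectorUnitary : Matrix n n ℂ) *ᵥ c) a‖ ^ 2 = ∑ i, ‖c i‖ ^ 2 := by
  have h : star (hA.eigenvectorUnitary : Matrix n n ℂ) * hA.eigenvectorUnitary = 1 :=
    Unitary.coe_star_mul_self _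
  apply Complex.ofReal_injective
  rw [sum_norm_sq_eq, sum_norm_sq_eq, star_mulVec, ← dotProduct_mulVec, mulVec_mulVec,
    ← star_eq_conjTranspose, h, one_mulVec]

theorem eig_eq {i : ℕ} (h1 : 1 ≤ i) (h2 : i ≤ Fintype.card n) :
    eig hA i = hA.eigenvalues (Fintype.equivOfCardEq (Fintype.card_fin _)
      (⟨Fintype.card n - i, by omega⟩ : Fin (Fintype.card n))) := by
  rw [eig, dif_pos ⟨h1, h2⟩, IsHermitian.eigenvalues, Equiv.symm_apply_apply]

theorem eig_one_le_eigenvalues (i : n) : eig hA 1 ≤ hA.eigenvalues i := by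
  have hc : 1 ≤ Fintype.card n := Fintype.card_pos_iff.2 ⟨i⟩
  rw [eig, dif_pos ⟨le_rfl, hc⟩]
  apply hA.eigenvalues₀_antitone
  rw [Fin.le_def]
  exact Nat.le_sub_one_of_lt (Fin.is_lt _)

theorem le_eigenvalues {c : ℝ} (h : ∀ v : n → ℂ, c * ∑ a, ‖v a‖ ^ 2 ≤ quad A v) (i : n) :
    c ≤ hA.eigenvalues i := by
  have := h ((hA.eigenvectorUnitary : Matrix n n ℂ) *ᵥ Pi.single i 1)
  rw [quad_eigenvectorUnitary, sum_norm_sq_eigenvectorUnitary] at this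
  simpa [Pi.single_apply, apply_ite] using this

/-- The Rayleigh upper bound for the smallest eigenvalue. -/
theorem eig_one_mul_le (v : n → ℂ) : eig hA 1 * ∑ a, ‖v a‖ ^ 2 ≤ quad A v := by
  have hv : (hA.eigenvectorUnitary : Matrix n n ℂ) *ᵥ
      (star (hA.eigenvectorUnitary : Matrix n n ℂ) *ᵥ v) = v := by
    have h : (hA.eigenvectorUnitary : Matrix n n ℂ) * star (hA.eigenvectorUnitary : Matrix n n ℂ) =
        1 := Unitary.coe_mul_star_self _
    rw [mulVec_mulVec, h, one_mulVec]
  rw [← hv, quad_eigenvectorUnitary, sum_norm_sq_eigenvectorUnitary, Finset.mul_sum]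
  gcongr with i _
  exact eig_one_le_eigenvalues hA i

/-- The Courant–Fischer lower bound, for a coordinate hyperplane. -/
theorem le_eigenvalues_of_hyperplane {c : ℝ} (o : n)
    (h : ∀ v : n → ℂ, v o = 0 → c * ∑ a, ‖v a‖ ^ 2 ≤ quad A v) {p q : n} (hpq : p ≠ q)
    (hle : hA.eigenvalues p ≤ hA.eigenvalues q) : c ≤ hA.eigenvalues q := by
  set U : Matrix n n ℂ := (hA.eigenvectorUnitary : Matrix n n ℂ)
  -- The span of two eigenvectors meets the hyperplane `v o = 0` in a nonzero vector, whose Rayleigh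
  -- quotient is at most the larger eigenvalue.
  obtain ⟨α, β, hαβ, h0⟩ : ∃ α β : ℂ, 0 < ‖α‖ ^ 2 + ‖β‖ ^ 2 ∧ U o p * α + U o q * β = 0 := by
    by_cases hq : U o q = 0
    · exact ⟨0, 1, by simp, by simp [hq]⟩
    · refine ⟨U o q, -U o p, ?_, by ring⟩
      have : 0 < ‖U o q‖ := norm_pos_iff.2 hq
      positivity
  have key := h (U *ᵥ (Pi.single p α + Pi.single q β)) (by
    rw [mulVec_add, Pi.add_apply, mulVec_single, mulVec_single]
    simpa [mul_comm] using h0)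
  rw [quad_eigenvectorUnitary, sum_norm_sq_eigenvectorUnitary] at key
  have hs : ∀ w : n → ℝ, ∑ i, w i * ‖(Pi.single p α + Pi.single q β : n → ℂ) i‖ ^ 2 =
      w p * ‖α‖ ^ 2 + w q * ‖β‖ ^ 2 := by
    intro w
    rw [Finset.sum_eq_add p q hpq]
    · simp [hpq, hpq.symm]
    · rintro i - ⟨h1, h2⟩
      simp [h1, h2]
    · simp
    · simp
  have hs1 := hs fun _ => 1
  simp only [one_mul] at hs1
  rw [hs, hs1] at key
  have : hA.eigenvalues p * ‖α‖ ^ 2 ≤ hA.eigenvalues q * ‖α‖ ^ 2 := by gcongr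
  nlinarith

theorem le_eig_of_hyperplane {c : ℝ} (o : n)
    (h : ∀ v : n → ℂ, v o = 0 → c * ∑ a, ‖v a‖ ^ 2 ≤ quad A v) {j : ℕ} (hj : 2 ≤ j)
    (hjn : j ≤ Fintype.card n) : c ≤ eig hA j := by
  have h1 := eig_eq hA (i := 1) le_rfl (by omega)
  have h2 := eig_eq hA (i := j) (by omega) hjn
  rw [h2]
  -- `eigenvalues₀` is decreasing, so its last position holds `λ₁`. The position of `λ_j` differs
  -- from it because `j ≥ 2`.
  refine le_eigenvalues_of_hyperplane hA o h (p := Fintype.equivOfCardEq (Fintype.card_fin _)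
      (⟨Fintype.card n - 1, by omega⟩ : Fin (Fintype.card n))) ?_ ?_
  · simp only [ne_eq, EmbeddingLike.apply_eq_iff_eq, Fin.mk.injEq]
    omega
  · rw [← h1]
    exact eig_one_le_eigenvalues hA _

theorem eigenvalues_le_trace (h : ∀ v : n → ℂ, 0 ≤ quad A v) (i : n) :
    hA.eigenvalues i ≤ A.trace.re := by
  rw [hA.trace_eq_sum_eigenvalues, Complex.re_sum]
  simp only [RCLike.ofReal_eq_complex_ofReal, Complex.ofReal_re]
  exact Finset.single_le_sum (f := hA.eigenvalues)
    (fun j _ => le_eigenvalues hA (c := 0) (by simpa using h) j) (Finset.mem_univ i)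

end Rayleigh

/-! ### Reduction of the spectral claims to bounds for the form -/

theorem two_sub_two_cos_mem (t : ℝ) : 2 - 2 * Real.cos t ∈ Set.Icc (0 : ℝ) 4 :=
  ⟨by linarith [Real.cos_le_one t], by linarith [Real.neg_one_le_cos t]⟩

/-- The spectral claims follow from three bounds for the Hermitian forms of the symbol. -/
theorem spectralClaims_of_quad {k d : ℕ} {n : Type} [Fintype n] [DecidableEq n]
    (f : (Fin d → ℝ) → Matrix n n ℂ) (hcard : Fintype.card n = k ^ d)
    (hf : ∀ θ, (f θ).IsHermitian) (o : n) {M B₁ B₂ B₃ : ℝ}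
    (hB₁ : 0 < B₁) (hB₂ : 0 < B₂) (hB₃ : 0 < B₃)
    (htrace : ∀ θ, (f θ).trace.re ≤ M)
    (hones : ∀ θ, quad (f θ) (fun _ => 1) ≤ B₁ * ∑ j, (2 - 2 * Real.cos (θ j)))
    (hphase : ∀ θ v, (∑ j, (2 - 2 * Real.cos (θ j))) * ‖v o‖ ^ 2 ≤ B₂ * quad (f θ) v)
    (hdiff : ∀ θ v a, ‖v a - v o‖ ^ 2 ≤ B₃ * quad (f θ) v) : SpectralClaims k d f := by
  have hnn : ∀ θ v, 0 ≤ quad (f θ) v := fun θ v =>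
    nonneg_of_mul_nonneg_right ((sq_nonneg _).trans (hdiff θ v o)) hB₃
  have hs : ∀ θ : Fin d → ℝ, ∑ j, (2 - 2 * Real.cos (θ j)) ∈ Set.Icc (0 : ℝ) (4 * d) := fun θ =>
    ⟨Finset.sum_nonneg fun j _ => (two_sub_two_cos_mem _).1,
      (Finset.sum_le_sum fun j _ => (two_sub_two_cos_mem _).2).trans (by simp [mul_comm])⟩
  have hN : 0 < Fintype.card n := Fintype.card_pos_iff.2 ⟨o⟩
  have hN' : (0 : ℝ) < Fintype.card n := by exact_mod_cast hN
  have hpsd : ∀ θ, (f θ).PosSemidef := fun θ =>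
    (hf θ).posSemidef_iff_eigenvalues_nonneg.2
      fun i => le_eigenvalues (hf θ) (c := 0) (by simpa using hnn θ) i
  refine ⟨hcard, hf, ?_, ?_, ?_⟩
  -- At `θ = 0` the bound on the vector of ones is zero, and a positive semidefinite matrix
  -- annihilates every vector on which its form vanishes.
  · rw [← (hpsd 0).dotProduct_mulVec_zero_iff]
    have h1 := (hpsd 0).dotProduct_mulVec_nonneg fun _ => 1
    have h2 := hones 0
    simp only [Pi.zero_apply, Real.cos_zero, mul_one, sub_self, Finset.sum_const_zero,
      mul_zero] at h2
    refine le_antisymm ?_ h1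
    rw [Complex.le_def] at h1 ⊢
    exact ⟨h2, h1.2.symm⟩
  -- From `‖v a‖² ≤ 2‖v a - v o‖² + 2‖v o‖²` and `s ≤ 4d`, each `s ‖v a‖²` is at most `(8 d B₃ + 2
  -- B₂)` times the form. Summing over `a` gives `D`.
  · set D : ℝ := Fintype.card n * (8 * d * B₃ + 2 * B₂) with hD
    have hDpos : 0 < D := by positivity
    refine ⟨1 / D, B₁ / Fintype.card n, by positivity, by positivity, fun θ _ => ⟨?_, ?_⟩⟩
    · rw [eig_eq (hf θ) le_rfl hN]
      refine le_eigenvalues _ (fun v => ?_) _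
      rw [div_mul_eq_mul_div, one_mul, div_mul_eq_mul_div, div_le_iff₀ hDpos]
      have hterm : ∀ a ∈ Finset.univ, (∑ j, (2 - 2 * Real.cos (θ j))) * ‖v a‖ ^ 2 ≤
          (8 * d * B₃ + 2 * B₂) * quad (f θ) v := by
        intro a _
        have h1 : ‖v a‖ ^ 2 ≤ 2 * ‖v a - v o‖ ^ 2 + 2 * ‖v o‖ ^ 2 := by
          have : ‖v a‖ ≤ ‖v a - v o‖ + ‖v o‖ := norm_le_norm_sub_add _ _
          nlinarith [norm_nonneg (v a), sq_nonneg (‖v a - v o‖ - ‖v o‖)]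
        have h2 := hdiff θ v a
        have h3 := hphase θ v
        obtain ⟨h4, h5⟩ := hs θ
        have h6 : (∑ j, (2 - 2 * Real.cos (θ j))) * ‖v a - v o‖ ^ 2 ≤
            4 * d * (B₃ * quad (f θ) v) := mul_le_mul h5 h2 (sq_nonneg _) (by positivity)
        nlinarith
      have := Finset.sum_le_sum hterm
      rw [← Finset.mul_sum, Finset.sum_const, Finset.card_univ, nsmul_eq_mul, ← mul_assoc] at this
      linarith
    · have h1 := (eig_one_mul_le (hf θ) fun _ => 1).trans (hones θ)
      simp only [norm_one, one_pow, Finset.sum_const, Finset.card_univ, nsmul_eq_mul,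
        mul_one] at h1
      rw [div_mul_eq_mul_div, le_div_iff₀ hN']
      exact h1
  · refine ⟨1 / (Fintype.card n * B₃), max M 1, by positivity, by positivity, ?_⟩
    intro θ _ j hj hjk
    rw [← hcard] at hjk
    refine ⟨le_eig_of_hyperplane (hf θ) o (fun v hv => ?_) hj hjk, ?_⟩
    · rw [div_mul_eq_mul_div, one_mul, div_le_iff₀ (by positivity)]
      have hterm : ∀ a ∈ Finset.univ, ‖v a‖ ^ 2 ≤ B₃ * quad (f θ) v := by
        intro a _
        simpa [hv] using hdiff θ v a
      have := Finset.sum_le_sum hterm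
      rw [Finset.sum_const, Finset.card_univ, nsmul_eq_mul] at this
      linarith
    · rw [eig_eq (hf θ) (by omega) hjk]
      refine (eigenvalues_le_trace (hf θ) (hnn θ) _).trans (le_max_of_le_left (htrace θ))

/-! ### Phases, and real element matrices acting on complex nodal values -/

theorem star_exp_mul_I (t : ℝ) :
    star (Complex.exp (t * Complex.I)) = Complex.exp (-(t * Complex.I)) := by
  rw [Complex.star_def, ← Complex.exp_conj]
  simp

theorem exists_conj_exp_mul_I {t : ℝ} {x : ℂ} (hx : Complex.exp (t * Complex.I) = x) :
    ∃ x' : ℂ, Complex.exp (-(t * Complex.I)) = x' ∧ star x = x' ∧ star x' = x ∧ x * x' = 1 ∧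
      ((Real.cos t : ℝ) : ℂ) = (x + x') / 2 := by
  subst hx
  refine ⟨_, rfl, star_exp_mul_I t, ?_, ?_, ?_⟩
  · rw [← star_exp_mul_I, star_star]
  · rw [← Complex.exp_add, add_neg_cancel, Complex.exp_zero]
  · rw [Complex.ofReal_cos, Complex.cos, neg_mul]

theorem form_map_ofReal_im {m : Type} [Fintype m] {E : Matrix m m ℝ} (hE : E.IsSymm)
    (w : m → ℂ) : (form (E.map Complex.ofReal) w).im = 0 := by
  rw [← Complex.conj_eq_iff_im, form_eq_sum, map_sum, Finset.sum_comm]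
  simp only [map_sum]
  refine Finset.sum_congr rfl fun i _ => Finset.sum_congr rfl fun j _ => ?_
  rw [map_apply, map_apply, hE.apply]
  simp
  ring

theorem quad_map_ofReal {m : Type} [Fintype m] (E : Matrix m m ℝ) (w : m → ℂ) :
    quad (E.map Complex.ofReal) w =
      (fun a => (w a).re) ⬝ᵥ E *ᵥ (fun a => (w a).re) +
      (fun a => (w a).im) ⬝ᵥ E *ᵥ (fun a => (w a).im) := by
  rw [quad, form_eq_sum]
  simp only [dotProduct, mulVec, Complex.re_sum, Finset.mul_sum, ← Finset.sum_add_distrib]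
  refine Finset.sum_congr rfl fun i _ => Finset.sum_congr rfl fun j _ => ?_
  simp
  ring

theorem dotProduct_mulVec_sub_const {m : Type} [Fintype m] {E : Matrix m m ℝ} (hE : E.IsSymm)
    (h1 : E *ᵥ (fun _ => 1) = 0) (z : m → ℝ) (c : ℝ) :
    (z - fun _ => c) ⬝ᵥ E *ᵥ (z - fun _ => c) = z ⬝ᵥ E *ᵥ z := by
  have hc : E *ᵥ (fun _ => c) = 0 := by
    have : (fun _ : m => c) = c • fun _ : m => (1 : ℝ) := by ext; simp
    rw [this, mulVec_smul, h1, smul_zero]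
  have hc' : (fun _ => c) ᵥ* E = 0 := by rw [← mulVec_transpose, hE.eq, hc]
  rw [mulVec_sub, hc, sub_zero, sub_dotProduct, dotProduct_mulVec (fun _ => c), hc',
    zero_dotProduct, sub_zero]

/-- Constants lie in the kernel of `E`, so `z` may be shifted to vanish at node 0. Only the block
without that node then contributes, and it is definite by `hB`. -/
theorem sq_sub_le_of_sum_sq_le {m : ℕ} {E : Matrix (Fin (m + 1)) (Fin (m + 1)) ℝ} (hE : E.IsSymm)
    (h1 : E *ᵥ (fun _ => 1) = 0) {B : ℝ}
    (hB : ∀ y, ∑ a, y a ^ 2 ≤ B * (y ⬝ᵥ E.submatrix Fin.succ Fin.succ *ᵥ y))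
    (z : Fin (m + 1) → ℝ) (a : Fin (m + 1)) : (z a - z 0) ^ 2 ≤ B * (z ⬝ᵥ E *ᵥ z) := by
  have h := hB fun a => z a.succ - z 0
  have h2 : (fun a : Fin m => z a.succ - z 0) ⬝ᵥ E.submatrix Fin.succ Fin.succ *ᵥ
      (fun a : Fin m => z a.succ - z 0) = z ⬝ᵥ E *ᵥ z := by
    rw [← dotProduct_mulVec_sub_const hE h1 z (z 0)]
    simp [dotProduct, mulVec, Fin.sum_univ_succ]
  rw [h2] at h
  refine le_trans ?_ h
  induction a using Fin.cases with
  | zero =>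
    rw [sub_self, zero_pow two_ne_zero]
    positivity
  | succ a =>
    exact Finset.single_le_sum (f := fun a : Fin m => (z a.succ - z 0) ^ 2)
      (fun _ _ => sq_nonneg _) (Finset.mem_univ a)

theorem norm_sq_sub_le_quad {m : ℕ} {E : Matrix (Fin (m + 1)) (Fin (m + 1)) ℝ} (hE : E.IsSymm)
    (h1 : E *ᵥ (fun _ => 1) = 0) {B : ℝ}
    (hB : ∀ y, ∑ a, y a ^ 2 ≤ B * (y ⬝ᵥ E.submatrix Fin.succ Fin.succ *ᵥ y))
    (w : Fin (m + 1) → ℂ) (a : Fin (m + 1)) :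
    ‖w a - w 0‖ ^ 2 ≤ B * quad (E.map Complex.ofReal) w := by
  have h2 := sq_sub_le_of_sum_sq_le hE h1 hB (fun a => (w a).re) a
  have h3 := sq_sub_le_of_sum_sq_le hE h1 hB (fun a => (w a).im) a
  rw [quad_map_ofReal, Complex.sq_norm, Complex.normSq_apply, Complex.sub_re, Complex.sub_im]
  linarith

theorem norm_sq_sub_le_four_mul {a b o : ℂ} {q : ℝ} (ha : ‖a - o‖ ^ 2 ≤ q)
    (hb : ‖b - o‖ ^ 2 ≤ q) : ‖a - b‖ ^ 2 ≤ 4 * q := by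
  have h := norm_sub_le_norm_sub_add_norm_sub a o b
  rw [norm_sub_rev o b] at h
  nlinarith [norm_nonneg (a - b), sq_nonneg (‖a - o‖ - ‖b - o‖)]

theorem norm_one_sub_exp_mul_I_sq (t : ℝ) :
    ‖1 - Complex.exp (t * Complex.I)‖ ^ 2 = 2 - 2 * Real.cos t := by
  rw [Complex.sq_norm, Complex.normSq_apply]
  simp only [Complex.sub_re, Complex.one_re, Complex.exp_ofReal_mul_I_re, Complex.sub_im,
    Complex.one_im, Complex.exp_ofReal_mul_I_im]
  nlinarith [Real.sin_sq_add_cos_sq t]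

/-! ### The symbols of the `ℙ₂` and `ℙ₃` elements -/

/-- The element stiffness matrix of the `ℙ₂` elements on the triangle with vertices `(0, 0)`,
`(1, 0)`, `(0, 1)`, for the nodes `(i / 2, j / 2)`, `i + j ≤ 2`, ordered by `j` first. -/
noncomputable def elementP2 : Matrix (Fin 6) (Fin 6) ℝ :=
  !![1, -2/3, 1/6, -2/3, 0, 1/6;
     -2/3, 8/3, -2/3, 0, -4/3, 0;
     1/6, -2/3, 1/2, 0, 0, 0;
     -2/3, 0, 0, 8/3, -4/3, -2/3;
     0, -4/3, 0, -4/3, 8/3, 0;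
     1/6, 0, 0, -2/3, 0, 1/2]

theorem elementP2_isSymm : elementP2.IsSymm := by
  ext i j
  fin_cases i <;> fin_cases j <;> rfl

theorem elementP2_mulVec_one : elementP2 *ᵥ (fun _ => 1) = 0 := by
  ext i
  fin_cases i <;> simp [elementP2, mulVec, dotProduct, Fin.sum_univ_succ] <;> norm_num

theorem sum_sq_le_elementP2 (y : Fin 5 → ℝ) :
    ∑ a, y a ^ 2 ≤ 10 * (y ⬝ᵥ elementP2.submatrix Fin.succ Fin.succ *ᵥ y) := by
  -- A sum-of-squares certificate for `10 E' - 1`, where `E'` is the element matrix without node 0.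
  have key : 10 * (y ⬝ᵥ elementP2.submatrix Fin.succ Fin.succ *ᵥ y) - ∑ a, y a ^ 2 =
        4/9 * (3 * y 1 - 5 * y 0) ^ 2 +
        1/1179 * (131 * y 0 - 120 * y 3) ^ 2 +
        4/9 * (3 * y 4 - 5 * y 2) ^ 2 +
        1/1179 * (131 * y 2 - 120 * y 3) ^ 2 +
        487/393 * (y 3) ^ 2 := by
    simp [elementP2, dotProduct, mulVec, Fin.sum_univ_succ]
    ring
  rw [← sub_nonneg, key]
  positivity

/-- The cell has corner values `v 3, x v 3, y v 3, xy v 3` and is cut by the diagonal with midpoint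
`v 0`. The two arguments list the nodal values on the two triangles, the first one rotated by a half
turn. -/
theorem fP2_form (θ : Fin 2 → ℝ) (v : Fin 4 → ℂ) {x y : ℂ}
    (hx : Complex.exp (θ 0 * Complex.I) = x) (hy : Complex.exp (θ 1 * Complex.I) = y) :
    form (fP2 θ) v =
      form (elementP2.map Complex.ofReal) ![x * y * v 3, y * v 2, y * v 3, x * v 1, v 0, x * v
        3] +
      form (elementP2.map Complex.ofReal) ![v 3, v 2, x * v 3, v 1, v 0, y * v 3] := by
  obtain ⟨x', hx', hsx, hsx', hxx, hcx⟩ := exists_conj_exp_mul_I hx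
  obtain ⟨y', hy', hsy, hsy', hyy, hcy⟩ := exists_conj_exp_mul_I hy
  simp only [form_eq_sum, fP2, hx, hy, hx', hy', Complex.ofReal_add, hcx, hcy]
  simp [elementP2, Fin.sum_univ_succ, hsx, hsy, -RCLike.star_def, -Complex.star_def]
  -- The two coefficients collect the products in which a phase meets its conjugate, which cancel by
  -- `x x' = 1` and `y y' = 1`.
  linear_combination
    -(1 * y' * y * star (v 3) * v 3 + (-2/3) * y' * star (v 3) * v 1 + 1/6 * y' * star (v 3) * v
      3 + (-2/3) * y * star (v 1) * v 3 + 8/3 * star (v 1) * v 1 + (-2/3) * star (v 1) * v 3 + 1/6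
      * y * star (v 3) * v 3 + (-2/3) * star (v 3) * v 1 + 1/2 * star (v 3) * v 3 + 1/2 * star (v
      3) * v 3) * hxx
    - (1 * star (v 3) * v 3 + (-2/3) * x' * star (v 3) * v 2 + 1/6 * x' * star (v 3) * v 3 +
      (-2/3) * x * star (v 2) * v 3 + 8/3 * star (v 2) * v 2 + (-2/3) * star (v 2) * v 3 + 1/6 * x
      * star (v 3) * v 3 + (-2/3) * star (v 3) * v 2 + 1/2 * star (v 3) * v 3 + 1/2 * star (v 3) *
      v 3) * hyy

theorem quad_fP2_one (θ : Fin 2 → ℝ) :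
    quad (fP2 θ) (fun _ => 1) =
      28 / 3 - 14 / 3 * (Real.cos (θ 0) + Real.cos (θ 1)) := by
  obtain ⟨x', hx', hsx, hsx', hxx, hcx⟩ := exists_conj_exp_mul_I (t := θ 0) rfl
  obtain ⟨y', hy', hsy, hsy', hyy, hcy⟩ := exists_conj_exp_mul_I (t := θ 1) rfl
  rw [quad, ← Complex.ofReal_re (28 / 3 - 14 / 3 * (Real.cos (θ 0) + Real.cos (θ 1)))]
  congr 1
  simp only [form_eq_sum, fP2, hx', hy', Complex.ofReal_add]
  push_cast [-Complex.ofReal_cos]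
  rw [hcx, hcy]
  simp [Fin.sum_univ_succ]
  ring

theorem trace_fP2 (θ : Fin 2 → ℝ) :
    (fP2 θ).trace = (20 + 2 / 3 * (Real.cos (θ 0) + Real.cos (θ 1)) : ℝ) := by
  simp [fP2, trace, Fin.sum_univ_succ]
  ring

/-- The element stiffness matrix of the `ℙ₃` elements on the triangle with vertices `(0, 0)`,
`(1, 0)`, `(0, 1)`, for the nodes `(i / 3, j / 3)`, `i + j ≤ 3`, ordered by `j` first. -/
noncomputable def elementP3 : Matrix (Fin 10) (Fin 10) ℝ :=
  !![17/20, -51/80, 3/8, -7/80, -51/80, 0, -3/40, 3/8, -3/40, -7/80;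
     -51/80, 27/8, -27/16, 27/80, 0, -81/40, 27/80, 0, 27/80, -3/80;
     3/8, -27/16, 27/8, -27/40, 0, 0, -27/16, 0, 27/80, -3/80;
     -7/80, 27/80, -27/40, 17/40, -3/80, 0, 3/80, -3/80, 3/80, 0;
     -51/80, 0, 0, -3/80, 27/8, -81/40, 27/80, -27/16, 27/80, 27/80;
     0, -81/40, 0, 0, -81/40, 81/10, -81/40, 0, -81/40, 0;
     -3/40, 27/80, -27/16, 3/80, 27/80, -81/40, 27/8, 27/80, -27/40, 3/80;
     3/8, 0, 0, -3/80, -27/16, 0, 27/80, 27/8, -27/16, -27/40;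
     -3/40, 27/80, 27/80, 3/80, 27/80, -81/40, -27/40, -27/16, 27/8, 3/80;
     -7/80, -3/80, -3/80, 0, 27/80, 0, 3/80, -27/40, 3/80, 17/40]

theorem elementP3_isSymm : elementP3.IsSymm := by
  ext i j
  fin_cases i <;> fin_cases j <;> rfl

theorem elementP3_mulVec_one : elementP3 *ᵥ (fun _ => 1) = 0 := by
  ext i
  fin_cases i <;> simp [elementP3, mulVec, dotProduct, Fin.sum_univ_succ] <;> norm_num

theorem sum_sq_le_elementP3 (y : Fin 9 → ℝ) :
    ∑ a, y a ^ 2 ≤ 20 * (y ⬝ᵥ elementP3.submatrix Fin.succ Fin.succ *ᵥ y) := by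
  -- The same kind of certificate, now for `20 E' - 1`.
  have key : 20 * (y ⬝ᵥ elementP3.submatrix Fin.succ Fin.succ *ᵥ y) - ∑ a, y a ^ 2 =
        3/40 * (10 * y 8 + y 5 + y 7 + 9 * y 3 - y 0 - y 1 - 18 * y 6) ^ 2 +
        1/106280 * (2657 * y 5 - 543 * y 7 + 30 * y 2 - 1620 * y 4 + 243 * y 3 + 273 * y 0 -
          1347 * y 1 + 324 * y 6) ^ 2 +
        1/1797407360 * (338240 * y 7 + 4800 * y 2 - 259200 * y 4 + 38880 * y 3 + 43680 * y 0 -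
          303 * y 1 - 163377 * y 6) ^ 2 +
        3/44563120 * (10540 * y 2 + 1620 * y 4 - 1300 * y 3 + 9240 * y 0 - 18489 * y 1 - 571 * y
          6) ^ 2 +
        1/438818144 * (208168 * y 4 - 65448 * y 3 - 65448 * y 0 - 39123 * y 1 - 39123 * y 6) ^ 2 +
        1/532501238048 * (5116072 * y 3 - 1024884 * y 0 - 384255 * y 1 - 2570019 * y 6) ^ 2 +
        1/1234917930038624 * (241380092 * y 0 - 130108557 * y 1 - 44193609 * y 6) ^ 2 +
        1/13225318935597861649280 * (342440184949 * y 1 - 308216217789 * y 6) ^ 2 +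
        4612651187437/2739521479592 * (y 6) ^ 2 := by
    simp [elementP3, dotProduct, mulVec, Fin.sum_univ_succ]
    ring
  rw [← sub_nonneg, key]
  positivity

theorem fP3_form (θ : Fin 2 → ℝ) (v : Fin 9 → ℂ) {x y : ℂ}
    (hx : Complex.exp (θ 0 * Complex.I) = x) (hy : Complex.exp (θ 1 * Complex.I) = y) :
    form (fP3 θ) v =
      form (elementP3.map Complex.ofReal) ![x * y * v 8, y * v 6, y * v 7, y * v 8, x * v 2, v
        0, v 1, x * v 5, v 3, x * v 8] +
      form (elementP3.map Complex.ofReal) ![v 8, v 7, v 6, x * v 8, v 5, v 4, v 3, v 2, v 1, y *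
        v 8] := by
  obtain ⟨x', hx', hsx, hsx', hxx, hcx⟩ := exists_conj_exp_mul_I hx
  obtain ⟨y', hy', hsy, hsy', hyy, hcy⟩ := exists_conj_exp_mul_I hy
  simp only [form_eq_sum, fP3, hx, hy, hx', hy', Complex.ofReal_add, hcx, hcy]
  simp [elementP3, Fin.sum_univ_succ, hsx, hsy, hsx', hsy', -RCLike.star_def, -Complex.star_def]
  linear_combination
    -(17/20 * y' * y * star (v 8) * v 8 + (-51/80) * y' * star (v 8) * v 2 + 3/8 * y' * star (v
      8) * v 5 + (-7/80) * y' * star (v 8) * v 8 + (-51/80) * y * star (v 2) * v 8 + 27/8 * star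
      (v 2) * v 2 + (-27/16) * star (v 2) * v 5 + 27/80 * star (v 2) * v 8 + 3/8 * y * star (v 5)
      * v 8 + (-27/16) * star (v 5) * v 2 + 27/8 * star (v 5) * v 5 + (-27/40) * star (v 5) * v 8
      + (-7/80) * y * star (v 8) * v 8 + 27/80 * star (v 8) * v 2 + (-27/40) * star (v 8) * v 5 +
      17/40 * star (v 8) * v 8 + 17/40 * star (v 8) * v 8) * hxx
    - (17/20 * star (v 8) * v 8 + (-51/80) * x' * star (v 8) * v 6 + 3/8 * x' * star (v 8) * v 7
      + (-7/80) * x' * star (v 8) * v 8 + (-51/80) * x * star (v 6) * v 8 + 27/8 * star (v 6) * v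
      6 + (-27/16) * star (v 6) * v 7 + 27/80 * star (v 6) * v 8 + 3/8 * x * star (v 7) * v 8 +
      (-27/16) * star (v 7) * v 6 + 27/8 * star (v 7) * v 7 + (-27/40) * star (v 7) * v 8 +
      (-7/80) * x * star (v 8) * v 8 + 27/80 * star (v 8) * v 6 + (-27/40) * star (v 8) * v 7 +
      17/40 * star (v 8) * v 8 + 17/40 * star (v 8) * v 8) * hyy

theorem quad_fP3_one (θ : Fin 2 → ℝ) :
    quad (fP3 θ) (fun _ => 1) =
      71 / 5 - 34 / 5 * (Real.cos (θ 0) + Real.cos (θ 1)) - 3 / 5 * Real.cos (θ 0) * Real.cos (θ 1) := by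
  obtain ⟨x', hx', hsx, hsx', hxx, hcx⟩ := exists_conj_exp_mul_I (t := θ 0) rfl
  obtain ⟨y', hy', hsy, hsy', hyy, hcy⟩ := exists_conj_exp_mul_I (t := θ 1) rfl
  rw [quad,
    ← Complex.ofReal_re (71 / 5 - 34 / 5 * (Real.cos (θ 0) + Real.cos (θ 1)) -
    3 / 5 * Real.cos (θ 0) * Real.cos (θ 1))]
  congr 1
  simp only [form_eq_sum, fP3, hx', hy', Complex.ofReal_add]
  push_cast [-Complex.ofReal_cos]
  rw [hcx, hcy]
  simp [Fin.sum_univ_succ, hsx, hsy, hsx', hsy', -RCLike.star_def, -Complex.star_def]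
  ring

theorem trace_fP3 (θ : Fin 2 → ℝ) :
    (fP3 θ).trace = (601 / 10 - 7 / 20 * (Real.cos (θ 0) + Real.cos (θ 1)) : ℝ) := by
  simp [fP3, trace, Fin.sum_univ_succ]
  ring

theorem fP2_isHermitian (θ : Fin 2 → ℝ) : (fP2 θ).IsHermitian := by
  refine isHermitian_of_form_im_eq_zero fun v => ?_
  rw [fP2_form θ v rfl rfl, Complex.add_im, form_map_ofReal_im elementP2_isSymm,
    form_map_ofReal_im elementP2_isSymm, add_zero]

theorem fP3_isHermitian (θ : Fin 2 → ℝ) : (fP3 θ).IsHermitian := by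
  refine isHermitian_of_form_im_eq_zero fun v => ?_
  rw [fP3_form θ v rfl rfl, Complex.add_im, form_map_ofReal_im elementP3_isSymm,
    form_map_ofReal_im elementP3_isSymm, add_zero]

theorem norm_exp_mul_sub_self_sq (t : ℝ) (z : ℂ) :
    ‖Complex.exp (t * Complex.I) * z - z‖ ^ 2 = (2 - 2 * Real.cos t) * ‖z‖ ^ 2 := by
  rw [← norm_one_sub_exp_mul_I_sq, ← mul_pow, ← norm_mul, sub_mul, one_mul, norm_sub_rev]

theorem spectralClaims_fP2 : SpectralClaims 2 2 fP2 := by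
  have key := norm_sq_sub_le_quad elementP2_isSymm elementP2_mulVec_one sum_sq_le_elementP2
  -- Node 3 is the vertex. The second triangle carries every `v a` unshifted, which gives `B₃ = 10`.
  -- It also carries `x v 3` and `y v 3`, which gives 10 per direction and `B₂ = 20`. The first
  -- triangle only has to have nonnegative energy.
  refine spectralClaims_of_quad fP2 (by simp) fP2_isHermitian 3
    (M := 22) (B₁ := 3) (B₂ := 20) (B₃ := 10) (by norm_num) (by norm_num) (by norm_num) ?_ ?_ ?_ ?_
  · intro θ
    rw [trace_fP2, Complex.ofReal_re]
    linarith [Real.cos_le_one (θ 0), Real.cos_le_one (θ 1)]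
  · intro θ
    rw [quad_fP2_one, Fin.sum_univ_two]
    linarith [Real.cos_le_one (θ 0), Real.cos_le_one (θ 1)]
  all_goals
    intro θ v
    have hq := congrArg Complex.re (fP2_form θ v rfl rfl)
    rw [Complex.add_re] at hq
    change quad _ _ = quad _ _ + quad _ _ at hq
    have h1 := (sq_nonneg _).trans (key (![Complex.exp (θ 0 * Complex.I) *
      Complex.exp (θ 1 * Complex.I) * v 3, Complex.exp (θ 1 * Complex.I) * v 2,
      Complex.exp (θ 1 * Complex.I) * v 3, Complex.exp (θ 0 * Complex.I) * v 1, v 0,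
      Complex.exp (θ 0 * Complex.I) * v 3]) 0)
    have h2 := key (![v 3, v 2, Complex.exp (θ 0 * Complex.I) * v 3, v 1, v 0,
      Complex.exp (θ 1 * Complex.I) * v 3])
  · have hx := h2 2
    have hy := h2 5
    simp only [cons_val, norm_exp_mul_sub_self_sq] at hx hy
    rw [Fin.sum_univ_two]
    linarith
  · have h3 : ∀ {t q : ℝ}, t ≤ q → q ≤ 10 * quad (fP2 θ) v → t ≤ 10 * quad (fP2 θ) v := le_trans
    intro a
    fin_cases a
    · exact h3 (h2 4) (by linarith)
    · exact h3 (h2 3) (by linarith)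
    · exact h3 (h2 1) (by linarith)
    · exact h3 (h2 0) (by linarith)

theorem spectralClaims_fP3 : SpectralClaims 3 2 fP3 := by
  have key := norm_sq_sub_le_quad elementP3_isSymm elementP3_mulVec_one sum_sq_le_elementP3
  refine spectralClaims_of_quad fP3 (by simp) fP3_isHermitian 8
    (M := 61) (B₁ := 4) (B₂ := 40) (B₃ := 320) (by norm_num) (by norm_num) (by norm_num) ?_ ?_ ?_ ?_
  · intro θ
    rw [trace_fP3, Complex.ofReal_re]
    linarith [Real.neg_one_le_cos (θ 0), Real.neg_one_le_cos (θ 1)]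
  · intro θ
    rw [quad_fP3_one, Fin.sum_univ_two]
    nlinarith [Real.cos_le_one (θ 0), Real.cos_le_one (θ 1)]
  all_goals
    intro θ v
    have hq := congrArg Complex.re (fP3_form θ v rfl rfl)
    rw [Complex.add_re] at hq
    change quad _ _ = quad _ _ + quad _ _ at hq
    have h1 := key (![Complex.exp (θ 0 * Complex.I) * Complex.exp (θ 1 * Complex.I) * v 8,
      Complex.exp (θ 1 * Complex.I) * v 6, Complex.exp (θ 1 * Complex.I) * v 7,
      Complex.exp (θ 1 * Complex.I) * v 8, Complex.exp (θ 0 * Complex.I) * v 2, v 0, v 1,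
      Complex.exp (θ 0 * Complex.I) * v 5, v 3, Complex.exp (θ 0 * Complex.I) * v 8])
    have h2 := key (![v 8, v 7, v 6, Complex.exp (θ 0 * Complex.I) * v 8, v 5, v 4, v 3, v 2, v 1,
      Complex.exp (θ 1 * Complex.I) * v 8])
    have h10 := (sq_nonneg _).trans (h1 0)
    have h20 := (sq_nonneg _).trans (h2 0)
  · have hx := h2 3
    have hy := h2 9
    simp only [cons_val, norm_exp_mul_sub_self_sq] at hx hy
    rw [Fin.sum_univ_two]
    linarith
  · have h3 : ∀ {t q : ℝ}, t ≤ q → q ≤ 320 * quad (fP3 θ) v → t ≤ 320 * quad (fP3 θ) v := le_trans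
    intro a
    fin_cases a
    -- `v 0` is the interior node of the first triangle and is absent from the second. It is
    -- compared with `v 8` through `v 1` on the common diagonal. Each of the two passages costs a
    -- factor 4, hence `B₃ = 4 · 4 · 20 = 320`.
    · have h4 := norm_sq_sub_le_four_mul (h1 5) (h1 6)
      have h5 := h2 8
      simp only [cons_val] at h4 h5
      rw [norm_sub_rev] at h5
      have h6 : ‖v 0 - v 1‖ ^ 2 ≤ 80 * quad (fP3 θ) v := h4.trans (by linarith)
      have h7 : ‖v 8 - v 1‖ ^ 2 ≤ 80 * quad (fP3 θ) v := h5.trans (by linarith)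
      exact h3 (norm_sq_sub_le_four_mul h6 h7) (by linarith)
    · exact h3 (h2 8) (by linarith)
    · exact h3 (h2 7) (by linarith)
    · exact h3 (h2 6) (by linarith)
    · exact h3 (h2 5) (by linarith)
    · exact h3 (h2 4) (by linarith)
    · exact h3 (h2 2) (by linarith)
    · exact h3 (h2 1) (by linarith)
    · exact h3 (h2 0) (by linarith)

/-! ### Stiffness and mass forms of the Lagrange basis on `[0, 1]` -/

section Lagrange

theorem sum_mul_integral_mul {ι : Type} [Fintype ι] (p : ι → ℝ[X]) (z : ι → ℝ) :
    z ⬝ᵥ of (fun i j => ∫ t in (0 : ℝ)..1, (p i).eval t * (p j).eval t) *ᵥ z =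
      ∫ t in (0 : ℝ)..1, (∑ i, C (z i) * p i).eval t ^ 2 := by
  have hint : ∀ q : ℝ[X], IntervalIntegrable (fun t => q.eval t) MeasureTheory.volume 0 1 :=
    fun q => q.continuous.intervalIntegrable _ _
  have h : ∀ t : ℝ, (∑ i, C (z i) * p i).eval t ^ 2 =
      ∑ i, ∑ j, z i * ((p i * p j).eval t * z j) := by
    intro t
    simp only [eval_finsetSum, eval_mul, eval_C, sq, Finset.sum_mul_sum]
    exact Finset.sum_congr rfl fun i _ => Finset.sum_congr rfl fun j _ => by ring
  simp only [h]
  rw [intervalIntegral.integral_finsetSum fun i _ => ?_]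
  · simp only [dotProduct, mulVec, of_apply, Finset.mul_sum]
    refine Finset.sum_congr rfl fun i _ => ?_
    rw [intervalIntegral.integral_finsetSum fun j _ => ?_]
    · refine Finset.sum_congr rfl fun j _ => ?_
      rw [intervalIntegral.integral_const_mul, intervalIntegral.integral_mul_const]
      simp
    · exact ((hint _).mul_const _).const_mul _
  · refine Continuous.intervalIntegrable (continuous_finsetSum _ fun j _ => ?_) _ _
    exact ((Polynomial.continuous _).mul continuous_const).const_mul _

variable {k : ℕ}

theorem knots_injective (hk : 1 ≤ k) :
    Function.Injective fun j : Fin (k + 1) => (j : ℝ) / (k : ℝ) := by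
  have hk' : (k : ℝ) ≠ 0 := by positivity
  intro i j hij
  simpa [div_left_inj' hk', Fin.ext_iff] using hij

theorem knot_mem (j : Fin (k + 1)) : (j : ℝ) / (k : ℝ) ∈ Set.Icc (0 : ℝ) 1 := by
  have h : ((j : ℕ) : ℝ) ≤ k := by exact_mod_cast Fin.is_le j
  exact ⟨by positivity, div_le_one_of_le₀ h (by positivity)⟩

theorem eval_sum_lagr (hk : 1 ≤ k) (z : Fin (k + 1) → ℝ) (j : Fin (k + 1)) :
    (∑ i, C (z i) * lagr k i).eval ((j : ℝ) / (k : ℝ)) = z j := by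
  have hinj := (knots_injective hk).injOn (s := (Finset.univ : Finset (Fin (k + 1))))
  rw [eval_finsetSum, Finset.sum_eq_single j]
  · have := Lagrange.eval_basis_self hinj (Finset.mem_univ j)
    simp only [eval_mul, eval_C, lagr]
    rw [this, mul_one]
  · intro i _ hij
    have := Lagrange.eval_basis_of_ne (v := fun j : Fin (k + 1) => (j : ℝ) / (k : ℝ)) hij
      (Finset.mem_univ j)
    simp only [eval_mul, eval_C, lagr]
    rw [this, mul_zero]
  · simp

theorem stiff_isSymm : (of (stiff k)).IsSymm := by
  ext i j
  simp [stiff, mul_comm]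

theorem mass_isSymm : (of (mass k)).IsSymm := by
  ext i j
  simp [mass, mul_comm]

/-- The Lagrange polynomials sum to 1, so their derivatives sum to 0. -/
theorem stiff_mulVec_one (hk : 1 ≤ k) : of (stiff k) *ᵥ (fun _ => 1) = 0 := by
  have hinj := (knots_injective hk).injOn (s := (Finset.univ : Finset (Fin (k + 1))))
  have h1 : ∑ j, derivative (lagr k j) = 0 := by
    rw [← derivative_sum]
    simp only [lagr]
    rw [Lagrange.sum_basis hinj Finset.univ_nonempty, derivative_one]
  ext i
  simp only [mulVec, dotProduct, of_apply, mul_one, stiff, Pi.zero_apply]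
  rw [← intervalIntegral.integral_finsetSum]
  · simp only [← Finset.mul_sum, ← eval_finsetSum, h1, eval_zero, mul_zero,
      intervalIntegral.integral_zero]
  · intro j _
    simp only [← eval_mul]
    exact (Polynomial.continuous _).intervalIntegrable _ _

/-- Cauchy–Schwarz on `[a, b]`: expanding `∫ (p' - c)² ≥ 0` with `c` the increment of `p` gives `∫
p'² ≥ (2 - (b - a)) c²`, and `b - a ≤ 1`. -/
theorem sq_sub_eval_le_integral (p : ℝ[X]) {a b : ℝ} (ha : 0 ≤ a) (hab : a ≤ b) (hb : b ≤ 1) :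
    (p.eval b - p.eval a) ^ 2 ≤ ∫ t in (0 : ℝ)..1, (derivative p).eval t ^ 2 := by
  set c := p.eval b - p.eval a with hc
  have hint : ∀ (q : ℝ[X]) (u v : ℝ),
      IntervalIntegrable (fun t => q.eval t) MeasureTheory.volume u v :=
    fun q u v => q.continuous.intervalIntegrable _ _
  have hint2 : ∀ u v : ℝ,
      IntervalIntegrable (fun t => (derivative p).eval t ^ 2) MeasureTheory.volume u v :=
    fun u v => ((derivative p).continuous.pow 2).intervalIntegrable _ _
  have hftc : ∫ t in a..b, (derivative p).eval t = c :=
    intervalIntegral.integral_eq_sub_of_hasDerivAt (fun t _ => p.hasDerivAt t) (hint _ _ _)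
  have hmono : ∫ t in a..b, (derivative p).eval t ^ 2 ≤
      ∫ t in (0 : ℝ)..1, (derivative p).eval t ^ 2 :=
    intervalIntegral.integral_mono_interval ha hab hb
      (Filter.Eventually.of_forall fun t => sq_nonneg _) (hint2 _ _)
  have hnn : 0 ≤ ∫ t in a..b, ((derivative p).eval t - c) ^ 2 :=
    intervalIntegral.integral_nonneg hab fun t _ => sq_nonneg _
  have hexp : ∫ t in a..b, ((derivative p).eval t - c) ^ 2 =
      (∫ t in a..b, (derivative p).eval t ^ 2) - 2 * c * c + (b - a) * c ^ 2 := by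
    have : ∀ t : ℝ, ((derivative p).eval t - c) ^ 2 =
        (derivative p).eval t ^ 2 - 2 * c * (derivative p).eval t + c ^ 2 := fun t => by ring
    simp only [this]
    rw [intervalIntegral.integral_add ((hint2 _ _).sub ((hint _ _ _).const_mul _))
      intervalIntegrable_const, intervalIntegral.integral_sub (hint2 _ _)
      ((hint _ _ _).const_mul _), intervalIntegral.integral_const_mul, hftc,
      intervalIntegral.integral_const, smul_eq_mul]
  nlinarith [sq_nonneg c]

theorem sq_sub_le_stiff (hk : 1 ≤ k) (z : Fin (k + 1) → ℝ) (i j : Fin (k + 1)) :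
    (z i - z j) ^ 2 ≤ z ⬝ᵥ of (stiff k) *ᵥ z := by
  have h := sum_mul_integral_mul (fun i => derivative (lagr k i)) z
  have h2 : ∑ i, C (z i) * derivative (lagr k i) = derivative (∑ i, C (z i) * lagr k i) := by
    simp
  rw [h2] at h
  refine le_trans ?_ h.ge
  rcases le_total ((i : ℝ) / (k : ℝ)) ((j : ℝ) / (k : ℝ)) with hij | hij
  · have := sq_sub_eval_le_integral (∑ i, C (z i) * lagr k i) (knot_mem i).1 hij (knot_mem j).2
    rw [eval_sum_lagr hk, eval_sum_lagr hk] at this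
    rwa [← neg_sub, neg_sq]
  · have := sq_sub_eval_le_integral (∑ i, C (z i) * lagr k i) (knot_mem j).1 hij (knot_mem i).2
    rwa [eval_sum_lagr hk, eval_sum_lagr hk] at this

/-- The form is the integral of the squared interpolant of `z`, which is nonzero at some knot. -/
theorem mass_pos (hk : 1 ≤ k) {z : Fin (k + 1) → ℝ} (hz : z ≠ 0) :
    0 < z ⬝ᵥ of (mass k) *ᵥ z := by
  obtain ⟨j, hj⟩ := Function.ne_iff.1 hz
  have h := sum_mul_integral_mul (lagr k) z
  refine lt_of_lt_of_eq ?_ h.symm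
  refine intervalIntegral.integral_pos one_pos
    ((Polynomial.continuous _).pow 2).continuousOn (fun t _ => sq_nonneg _)
    ⟨_, knot_mem j, ?_⟩
  rw [eval_sum_lagr hk]
  have hj' : z j ≠ 0 := hj
  positivity

end Lagrange

/-- A definite real quadratic form dominates a multiple of the square of the norm. -/
theorem exists_sq_le_of_pos {m : Type} [Fintype m] [Nonempty m] {E : Matrix m m ℝ}
    (hE : ∀ z : m → ℝ, z ≠ 0 → 0 < z ⬝ᵥ E *ᵥ z) :
    ∃ B : ℝ, 1 ≤ B ∧ ∀ (z : m → ℝ) (i : m), z i ^ 2 ≤ B * (z ⬝ᵥ E *ᵥ z) := by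
  have hcont : Continuous fun z : m → ℝ => z ⬝ᵥ E *ᵥ z := by
    simp only [dotProduct, mulVec]
    fun_prop
  have hne : (Metric.sphere (0 : m → ℝ) 1).Nonempty :=
    NormedSpace.sphere_nonempty.2 zero_le_one
  obtain ⟨z₀, hz₀, hmin⟩ := (isCompact_sphere (0 : m → ℝ) 1).exists_isMinOn hne hcont.continuousOn
  set c := z₀ ⬝ᵥ E *ᵥ z₀ with hc
  have hcpos : 0 < c := hE z₀ (ne_zero_of_mem_unit_sphere ⟨z₀, hz₀⟩)
  -- `c` is the minimum on the unit sphere of the sup norm. Taking `B ≥ 1` lets the same constant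
  -- serve for the stiffness bound, whose constant is 1.
  refine ⟨max 1 (1 / c), le_max_left _ _, fun z i => ?_⟩
  rcases eq_or_ne z 0 with rfl | hz
  · simp
  have hzpos : 0 < ‖z‖ := norm_pos_iff.2 hz
  have h1 : c ≤ (‖z‖⁻¹ • z) ⬝ᵥ E *ᵥ (‖z‖⁻¹ • z) := hmin (by
    rw [mem_sphere_zero_iff_norm, norm_smul, norm_inv, norm_norm, inv_mul_cancel₀ hzpos.ne'])
  rw [mulVec_smul, smul_dotProduct, dotProduct_smul, smul_eq_mul, smul_eq_mul, ← mul_assoc,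
    ← mul_inv, inv_mul_eq_div, le_div_iff₀ (by positivity)] at h1
  have h2 : z i ^ 2 ≤ ‖z‖ * ‖z‖ := by
    rw [← sq, ← sq_abs (z i)]
    exact pow_le_pow_left₀ (abs_nonneg _) (norm_le_pi_norm z i) 2
  have h3 : z i ^ 2 ≤ 1 / c * (z ⬝ᵥ E *ᵥ z) := by
    rw [div_mul_eq_mul_div, one_mul, le_div_iff₀ hcpos]
    nlinarith
  exact h3.trans (mul_le_mul_of_nonneg_right (le_max_right _ _) (hE z hz).le)

/-! ### The one-dimensional symbol as an element form -/

section Symbol1D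

variable {m : ℕ} {E : Fin (m + 2) → Fin (m + 2) → ℝ}

theorem symbol1D_apply (θ : ℝ) (i j : Fin (m + 1)) :
    symbol1D E θ i j = E j.succ i.succ +
      (if i = Fin.last m then if j = Fin.last m then (E 0 0 : ℂ) else 0 else 0) +
      Complex.exp (θ * Complex.I) * (if j = Fin.last m then (E 0 i.succ : ℂ) else 0) +
      Complex.exp (-(θ * Complex.I)) * (if i = Fin.last m then (E 0 j.succ : ℂ) else 0) := by
  have h : ∀ i : Fin (m + 1), (i : ℕ) = m ↔ i = Fin.last m := fun i => by
    rw [Fin.ext_iff, Fin.val_last]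
  simp [symbol1D, blockDiag, blockSub, h, ite_and, apply_ite (Complex.ofReal)]

/-- The values of a finite element function at the knots of an element, from its values at all
knots but the first one and the phase shift `exp (θ I)` between two elements. -/
noncomputable def knotValues (θ : ℝ) (v : Fin (m + 1) → ℂ) : Fin (m + 2) → ℂ :=
  Fin.cons (Complex.exp (θ * Complex.I) * v (Fin.last m)) v

/-- Knot 0 of an element is the last knot of its neighbour, so its value is a phase times `v
(Fin.last m)`. The phase has modulus 1 and disappears from the `E 0 0` term, so `θ` enters only
through the argument of a fixed element form. -/
theorem form_symbol1D (hE : (of E).IsSymm) (θ : ℝ) (v : Fin (m + 1) → ℂ) :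
    form (symbol1D E θ) v = form ((of E).map Complex.ofReal) (knotValues θ v) := by
  obtain ⟨x', hx', hsx, -, hxx, -⟩ := exists_conj_exp_mul_I (t := θ) rfl
  have hs : ∀ i j, E i j = E j i := fun i j => (hE.apply j i)
  rw [form_eq_sum, form_eq_sum, Fin.sum_univ_succ (n := m + 1)]
  simp only [Fin.sum_univ_succ (n := m + 1), symbol1D_apply, hx', mul_add, add_mul,
    Finset.sum_add_distrib, knotValues, Fin.cons_zero, Fin.cons_succ, star_mul', hsx, map_apply,
    of_apply]
  have h1 : ∑ i : Fin (m + 1), ∑ j : Fin (m + 1), star (v i) *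
      (if i = Fin.last m then if j = Fin.last m then (E 0 0 : ℂ) else 0 else 0) * v j =
      star (v (Fin.last m)) * E 0 0 * v (Fin.last m) := by
    rw [Finset.sum_eq_single (Fin.last m), Finset.sum_eq_single (Fin.last m)] <;>
      simp +contextual
  have h2 : ∑ i : Fin (m + 1), ∑ j : Fin (m + 1), star (v i) *
      (Complex.exp (θ * Complex.I) * if j = Fin.last m then (E 0 i.succ : ℂ) else 0) * v j =
      ∑ i : Fin (m + 1), star (v i) * E i.succ 0 *
        (Complex.exp (θ * Complex.I) * v (Fin.last m)) := by
    refine Finset.sum_congr rfl fun i _ => ?_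
    rw [Finset.sum_eq_single (Fin.last m), if_pos rfl, hs]
    · ring
    · simp +contextual
    · simp
  have h3 : ∑ i : Fin (m + 1), ∑ j : Fin (m + 1), star (v i) *
      (x' * if i = Fin.last m then (E 0 j.succ : ℂ) else 0) * v j =
      ∑ j : Fin (m + 1), x' * star (v (Fin.last m)) * E 0 j.succ * v j := by
    rw [Finset.sum_comm]
    refine Finset.sum_congr rfl fun i _ => ?_
    rw [Finset.sum_eq_single (Fin.last m), if_pos rfl]
    · ring
    · simp +contextual
    · simp
  have h4 : ∑ i : Fin (m + 1), ∑ j : Fin (m + 1), star (v i) * (E j.succ i.succ : ℂ) * v j =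
      ∑ i : Fin (m + 1), ∑ j : Fin (m + 1), star (v i) * (E i.succ j.succ : ℂ) * v j :=
    Finset.sum_congr rfl fun i _ => Finset.sum_congr rfl fun j _ => by rw [hs]
  rw [h1, h2, h3, h4]
  linear_combination (-star (v (Fin.last m)) * E 0 0 * v (Fin.last m)) * hxx

theorem symbol1D_isHermitian (hE : (of E).IsSymm) (θ : ℝ) : (symbol1D E θ).IsHermitian :=
  isHermitian_of_form_im_eq_zero fun v => by rw [form_symbol1D hE, form_map_ofReal_im hE]

theorem posSemidef_of_quad_nonneg {n : Type} [Fintype n] [DecidableEq n] {A : Matrix n n ℂ}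
    (hA : A.IsHermitian) (h : ∀ v, 0 ≤ quad A v) : A.PosSemidef :=
  hA.posSemidef_iff_eigenvalues_nonneg.2
    fun i => le_eigenvalues hA (c := 0) (by simpa using h) i

theorem norm_symbol1D_apply_le {K : ℝ} (hK : ∀ i j, |E i j| ≤ K) (θ : ℝ) (i j : Fin (m + 1)) :
    ‖symbol1D E θ i j‖ ≤ 4 * K := by
  have hK0 : 0 ≤ K := (abs_nonneg _).trans (hK 0 0)
  have he : ‖Complex.exp (-(θ * Complex.I))‖ = 1 := by
    rw [← star_exp_mul_I, norm_star, Complex.norm_exp_ofReal_mul_I]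
  have hE : ∀ i j, ‖(E i j : ℂ)‖ ≤ K := fun i j => by
    rw [Complex.norm_real]
    exact hK i j
  rw [symbol1D_apply]
  have h1 : ‖(if i = Fin.last m then if j = Fin.last m then (E 0 0 : ℂ) else 0 else 0)‖ ≤ K := by
    split_ifs <;> simp [hK0, hK]
  have h2 : ‖Complex.exp (θ * Complex.I) * (if j = Fin.last m then (E 0 i.succ : ℂ) else 0)‖ ≤
      K := by
    rw [norm_mul, Complex.norm_exp_ofReal_mul_I, one_mul]
    split_ifs <;> simp [hK0, hK]
  have h3 : ‖Complex.exp (-(θ * Complex.I)) * (if i = Fin.last m then (E 0 j.succ : ℂ) else 0)‖ ≤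
      K := by
    rw [norm_mul, he, one_mul]
    split_ifs <;> simp [hK0, hK]
  refine (norm_add_le_of_le (norm_add_le_of_le (norm_add_le_of_le (hE _ _) h1) h2) h3).trans ?_
  linarith

theorem norm_sq_sub_le_quad_stiff (θ : ℝ) (v : Fin (m + 1) → ℂ) (i j : Fin (m + 2)) :
    ‖knotValues θ v i - knotValues θ v j‖ ^ 2 ≤ quad (symbol1D (stiff (m + 1)) θ) v := by
  rw [quad, form_symbol1D stiff_isSymm, ← quad, quad_map_ofReal, Complex.sq_norm,
    Complex.normSq_apply, Complex.sub_re, Complex.sub_im, ← sq, ← sq]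
  exact add_le_add
    (sq_sub_le_stiff (Nat.le_add_left 1 m) (fun a => (knotValues θ v a).re) i j)
    (sq_sub_le_stiff (Nat.le_add_left 1 m) (fun a => (knotValues θ v a).im) i j)

/-- `B` is uniform in `θ` because compactness is applied to the element matrix, which does not
depend on `θ`. -/
theorem exists_norm_sq_le_quad_mass (m : ℕ) : ∃ B : ℝ, 1 ≤ B ∧ ∀ (θ : ℝ) (v : Fin (m + 1) → ℂ) i,
    ‖v i‖ ^ 2 ≤ B * quad (symbol1D (mass (m + 1)) θ) v := by
  obtain ⟨B, hB, h⟩ := exists_sq_le_of_pos fun z hz => mass_pos (Nat.le_add_left 1 m) (z := z) hz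
  refine ⟨B, hB, fun θ v i => ?_⟩
  have h1 := h (fun a => (knotValues θ v a).re) i.succ
  have h2 := h (fun a => (knotValues θ v a).im) i.succ
  rw [quad, form_symbol1D mass_isSymm, ← quad, quad_map_ofReal, Complex.sq_norm,
    Complex.normSq_apply, mul_add, ← sq, ← sq]
  exact add_le_add h1 h2

theorem form_stiff_one (θ : ℝ) : form (symbol1D (stiff (m + 1)) θ) (fun _ => 1) =
    (((2 - 2 * Real.cos θ) * stiff (m + 1) 0 0 : ℝ) : ℂ) := by
  have hsym := stiff_isSymm (k := m + 1)
  have hone := stiff_mulVec_one (Nat.le_add_left 1 m)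
  rw [form_symbol1D hsym]
  apply Complex.ext
  -- Subtracting the constant 1 from the real part leaves a vector supported at knot 0, so the form
  -- is `‖e^{iθ} - 1‖²` times the entry `stiff (m + 1) 0 0`.
  · rw [← quad, quad_map_ofReal, ← dotProduct_mulVec_sub_const hsym hone _ 1, Complex.ofReal_re]
    have h1 : ((fun a => (knotValues θ (fun _ : Fin (m + 1) => 1) a).re) - fun _ => 1) =
        Pi.single 0 (Real.cos θ - 1) := by
      ext a
      induction a using Fin.cases <;> simp [knotValues, Complex.exp_ofReal_mul_I_re]
    have h2 : (fun a => (knotValues θ (fun _ : Fin (m + 1) => 1) a).im) =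
        Pi.single 0 (Real.sin θ) := by
      ext a
      induction a using Fin.cases <;> simp [knotValues, Complex.exp_ofReal_mul_I_im]
    rw [h1, h2, single_dotProduct, single_dotProduct, mulVec_single, mulVec_single]
    simp
    linear_combination stiff (m + 1) 0 0 * Real.sin_sq_add_cos_sq θ
  · rw [form_map_ofReal_im hsym, Complex.ofReal_im]

end Symbol1D

/-! ### Kronecker products and the Loewner order -/

section Kronecker

variable {ι κ : Type} [Fintype ι]

/-- The Kronecker product of a family of matrices, indexed by multi-indices. -/
def piKron (A : ι → Matrix κ κ ℂ) : Matrix (ι → κ) (ι → κ) ℂ :=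
  of fun i j => ∏ s, A s (i s) (j s)

theorem piKron_smul (c : ι → ℂ) (A : ι → Matrix κ κ ℂ) :
    piKron (fun s => c s • A s) = (∏ s, c s) • piKron A := by
  ext i j
  simp [piKron, Finset.prod_mul_distrib]

theorem piKron_update_sub [DecidableEq ι] (A : ι → Matrix κ κ ℂ) (r : ι) (X Y : Matrix κ κ ℂ) :
    piKron (Function.update A r (X - Y)) =
      piKron (Function.update A r X) - piKron (Function.update A r Y) := by
  have h : ∀ (Z : Matrix κ κ ℂ) (i j : ι → κ), piKron (Function.update A r Z) i j =
      Z (i r) (j r) * ∏ s ∈ Finset.univ.erase r, A s (i s) (j s) := by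
    intro Z i j
    rw [piKron, of_apply, ← Finset.mul_prod_erase _ _ (Finset.mem_univ r), Function.update_self]
    congr 1
    refine Finset.prod_congr rfl fun s hs => ?_
    rw [Function.update_of_ne (Finset.ne_of_mem_erase hs)]
  ext i j
  rw [Matrix.sub_apply, h, h, h, Matrix.sub_apply, sub_mul]

variable [Fintype κ]

theorem form_piKron_one [DecidableEq ι] (A : ι → Matrix κ κ ℂ) :
    form (piKron A) (fun _ => 1) = ∏ s, form (A s) (fun _ => 1) := by
  simp only [form_eq_sum, star_one, one_mul, mul_one, Finset.prod_univ_sum, Fintype.piFinset_univ]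
  rfl

theorem piKron_conjTranspose_mul_self [DecidableEq ι] (A : ι → Matrix κ κ ℂ) :
    piKron (fun s => (A s)ᴴ * A s) = (piKron A)ᴴ * piKron A := by
  ext i j
  simp only [piKron, of_apply, mul_apply, conjTranspose_apply, Finset.prod_univ_sum,
    Fintype.piFinset_univ, Finset.prod_mul_distrib, star_prod]

open scoped MatrixOrder in
theorem exists_eq_conjTranspose_mul_self [DecidableEq κ] {A : Matrix κ κ ℂ} (hA : A.PosSemidef) :
    ∃ B : Matrix κ κ ℂ, A = Bᴴ * B :=
  CStarAlgebra.nonneg_iff_eq_star_mul_self.mp hA.nonneg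

variable [DecidableEq ι] [DecidableEq κ]

/-- Writing each factor as `Bᴴ B`, the product is again of this form by the mixed-product rule. -/
theorem posSemidef_piKron {A : ι → Matrix κ κ ℂ} (hA : ∀ s, (A s).PosSemidef) :
    (piKron A).PosSemidef := by
  choose B hB using fun s => exists_eq_conjTranspose_mul_self (hA s)
  rw [show A = fun s => (B s)ᴴ * B s from funext hB, piKron_conjTranspose_mul_self]
  exact posSemidef_conjTranspose_mul_self _

/-- The Kronecker product is monotone in the Loewner order. -/
theorem posSemidef_piKron_sub {A R : ι → Matrix κ κ ℂ} (hA : ∀ s, (A s).PosSemidef)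
    (hR : ∀ s, (R s).PosSemidef) (hAR : ∀ s, (A s - R s).PosSemidef) :
    (piKron A - piKron R).PosSemidef := by
  -- The factors are exchanged one at a time, `S` being the set already exchanged. By multilinearity
  -- each exchange changes the product by a Kronecker product with the single factor `A r - R r`,
  -- which is positive semidefinite.
  suffices h : ∀ S : Finset ι, (piKron A - piKron (S.piecewise R A)).PosSemidef by
    simpa using h Finset.univ
  intro S
  induction S using Finset.induction_on with
  | empty => simpa using PosSemidef.zero
  | insert r S hr ih =>
    have h1 : (piKron (Function.update (S.piecewise R A) r (A r - R r))).PosSemidef := by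
      refine posSemidef_piKron fun s => ?_
      by_cases hs : s = r
      · subst hs
        simpa using hAR s
      · rw [Function.update_of_ne hs]
        by_cases hS : s ∈ S <;> simp [hS, hA, hR]
    have h2 : Function.update (S.piecewise R A) r (A r) = S.piecewise R A := by
      rw [← Finset.piecewise_eq_of_notMem S R A hr, Function.update_eq_self]
    rw [piKron_update_sub, h2, ← Finset.piecewise_insert] at h1
    simpa using ih.add h1

theorem quad_nonneg {n : Type} [Fintype n] {A : Matrix n n ℂ} (hA : A.PosSemidef) (v : n → ℂ) :
    0 ≤ quad A v :=
  (Complex.le_def.1 (hA.dotProduct_mulVec_nonneg v)).1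

theorem form_sub {n : Type} [Fintype n] (A B : Matrix n n ℂ) (v : n → ℂ) :
    form (A - B) v = form A v - form B v := by
  simp [form, sub_mulVec]

theorem form_smul {n : Type} [Fintype n] (c : ℂ) (A : Matrix n n ℂ) (v : n → ℂ) :
    form (c • A) v = c * form A v := by
  simp [form, smul_mulVec]

theorem form_vecMulVec {n : Type} [Fintype n] (u v : n → ℂ) :
    form (vecMulVec u (star u)) v = ((‖∑ i, star (u i) * v i‖ ^ 2 : ℝ) : ℂ) := by
  push_cast
  rw [← Complex.conj_mul', form_eq_sum, map_sum, Finset.sum_mul_sum]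
  refine Finset.sum_congr rfl fun i _ => Finset.sum_congr rfl fun j _ => ?_
  simp [vecMulVec_apply]
  ring

/-- The hypothesis says `u_s u_s* ≤ B A_s` in the Loewner order. A Kronecker product of rank-one
matrices is the rank-one matrix of the product vector, so monotonicity multiplies the bounds. -/
theorem norm_sq_sum_prod_le_quad_piKron {A : ι → Matrix κ κ ℂ} (hA : ∀ s, (A s).PosSemidef)
    (u : ι → κ → ℂ) {B : ℝ} (hB : 0 ≤ B)
    (h : ∀ s v, ‖∑ a, star (u s a) * v a‖ ^ 2 ≤ B * quad (A s) v) (V : (ι → κ) → ℂ) :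
    ‖∑ i, star (∏ s, u s (i s)) * V i‖ ^ 2 ≤ B ^ Fintype.card ι * quad (piKron A) V := by
  have hB' : (0 : ℂ) ≤ B := by exact_mod_cast hB
  have hBA : ∀ s, ((B : ℂ) • A s).PosSemidef := fun s => (hA s).smul hB'
  have hR : ∀ s, (vecMulVec (u s) (star (u s))).PosSemidef :=
    fun s => posSemidef_vecMulVec_self_star _
  have h1 := posSemidef_piKron_sub (A := fun s => (B : ℂ) • A s) hBA hR fun s => by
    refine posSemidef_of_quad_nonneg ((hBA s).1.sub (hR s).1) fun v => ?_
    have := h s v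
    rw [quad, form_sub, form_smul, form_vecMulVec, Complex.sub_re, Complex.ofReal_re,
      Complex.re_ofReal_mul, ← quad]
    linarith
  have h2 : piKron (fun s => vecMulVec (u s) (star (u s))) =
      vecMulVec (fun i => ∏ s, u s (i s)) (star fun i => ∏ s, u s (i s)) := by
    ext i j
    simp [piKron, vecMulVec_apply, Finset.prod_mul_distrib]
  have h3 := quad_nonneg h1 V
  rw [piKron_smul, h2, quad, form_sub, form_smul, form_vecMulVec, Complex.sub_re,
    Complex.ofReal_re, Finset.prod_const, Finset.card_univ, ← Complex.ofReal_pow,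
    Complex.re_ofReal_mul, ← quad] at h3
  linarith

end Kronecker

/-! ### The symbol of the `ℚ_k` elements -/

section TensorSymbol

variable {m d : ℕ}

/-- The factors of the `r`-th summand of the tensor product symbol. -/
noncomputable def tensorFactor (m : ℕ) (θ : Fin d → ℝ) (r s : Fin d) :
    Matrix (Fin (m + 1)) (Fin (m + 1)) ℂ :=
  if s = r then symbol1D (stiff (m + 1)) (θ s) else symbol1D (mass (m + 1)) (θ s)

theorem fQ_eq_sum_piKron (θ : Fin d → ℝ) :
    fQ (m + 1) d θ = ∑ r, piKron (tensorFactor m θ r) := rfl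

theorem posSemidef_tensorFactor (θ : Fin d → ℝ) (r s : Fin d) :
    (tensorFactor m θ r s).PosSemidef := by
  rw [tensorFactor]
  split_ifs
  · exact posSemidef_of_quad_nonneg (symbol1D_isHermitian stiff_isSymm _) fun v =>
      (sq_nonneg _).trans (norm_sq_sub_le_quad_stiff (θ s) v 0 0)
  · obtain ⟨B, hB, h⟩ := exists_norm_sq_le_quad_mass m
    exact posSemidef_of_quad_nonneg (symbol1D_isHermitian mass_isSymm _) fun v =>
      nonneg_of_mul_nonneg_right ((sq_nonneg _).trans (h (θ s) v 0)) (by linarith)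

theorem posSemidef_fQ (θ : Fin d → ℝ) : (fQ (m + 1) d θ).PosSemidef := by
  rw [fQ_eq_sum_piKron]
  exact posSemidef_sum _ fun r _ => posSemidef_piKron fun s => posSemidef_tensorFactor θ r s

theorem quad_fQ (θ : Fin d → ℝ) (V : (Fin d → Fin (m + 1)) → ℂ) :
    quad (fQ (m + 1) d θ) V = ∑ r, quad (piKron (tensorFactor m θ r)) V := by
  rw [fQ_eq_sum_piKron, quad, form, sum_mulVec, dotProduct_sum, Complex.re_sum]
  rfl

theorem quad_piKron_le_quad_fQ (θ : Fin d → ℝ) (V : (Fin d → Fin (m + 1)) → ℂ) (r : Fin d) :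
    quad (piKron (tensorFactor m θ r)) V ≤ quad (fQ (m + 1) d θ) V := by
  rw [quad_fQ]
  exact Finset.single_le_sum (f := fun r => quad (piKron (tensorFactor m θ r)) V)
    (fun r _ => quad_nonneg (posSemidef_piKron fun s => posSemidef_tensorFactor θ r s) V)
    (Finset.mem_univ r)

theorem sum_star_single_mul {n : Type} [Fintype n] [DecidableEq n] (c : ℂ) (b : n) (v : n → ℂ) :
    ∑ a, star ((Pi.single b c : n → ℂ) a) * v a = star c * v b := by
  rw [Finset.sum_eq_single b] <;> simp +contextual

theorem prod_single_one {ι κ : Type} [Fintype ι] [DecidableEq ι] [DecidableEq κ] (i j : ι → κ) :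
    ∏ s, (Pi.single (i s) 1 : κ → ℂ) (j s) = (Pi.single i 1 : (ι → κ) → ℂ) j := by
  simp only [Pi.single_apply, Fintype.prod_ite_zero, funext_iff, Finset.prod_const_one]

theorem prod_update_eq {ι κ : Type} [Fintype ι] [DecidableEq ι] (u : ι → κ → ℂ) (r : ι)
    (w : κ → ℂ) (j : ι → κ) :
    ∏ s, Function.update u r w s (j s) = w (j r) * ∏ s ∈ Finset.univ.erase r, u s (j s) := by
  rw [← Finset.mul_prod_erase _ _ (Finset.mem_univ r), Function.update_self]
  congr 1
  refine Finset.prod_congr rfl fun s hs => ?_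
  rw [Function.update_of_ne (Finset.ne_of_mem_erase hs)]

/-- The difference is a product functional: a difference of two point values in coordinate `r`,
bounded by stiffness, and point evaluations in the others, bounded by mass. -/
theorem norm_sq_update_sub_le_quad_piKron {B : ℝ} (hB : 1 ≤ B)
    (hmass : ∀ (t : ℝ) (v : Fin (m + 1) → ℂ) a,
      ‖v a‖ ^ 2 ≤ B * quad (symbol1D (mass (m + 1)) t) v)
    (θ : Fin d → ℝ) (r : Fin d) (i : Fin d → Fin (m + 1)) (b : Fin (m + 1))
    (V : (Fin d → Fin (m + 1)) → ℂ) :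
    ‖V (Function.update i r b) - V i‖ ^ 2 ≤ B ^ d * quad (piKron (tensorFactor m θ r)) V := by
  set e : Fin d → Fin (m + 1) → ℂ := fun s => Pi.single (i s) 1 with he
  have key := norm_sq_sum_prod_le_quad_piKron (fun s => posSemidef_tensorFactor (m := m) θ r s)
    (Function.update e r (Pi.single b 1 - Pi.single (i r) 1)) (B := B) (by linarith)
    (fun s v => by
      rw [tensorFactor]
      split_ifs with h
      · subst h
        have h1 := norm_sq_sub_le_quad_stiff (θ s) v b.succ (i s).succ
        have h2 := (sq_nonneg _).trans h1
        simp only [Function.update_self, Pi.sub_apply, star_sub, sub_mul, Finset.sum_sub_distrib,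
          sum_star_single_mul, star_one, one_mul]
        simp only [knotValues, Fin.cons_succ] at h1
        nlinarith
      · rw [Function.update_of_ne h, he]
        simp only [sum_star_single_mul, star_one, one_mul]
        exact hmass _ _ _) V
  rw [Fintype.card_fin] at key
  have h1 : ∀ j : Fin d → Fin (m + 1),
      ∏ s, Function.update e r (Pi.single b 1 - Pi.single (i r) 1) s (j s) =
      (Pi.single (Function.update i r b) 1 - Pi.single i 1 : (Fin d → Fin (m + 1)) → ℂ) j := by
    intro j
    have h2 : e = Function.update e r (Pi.single (i r) 1) := (Function.update_eq_self r e).symm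
    have h3 : (fun s => Pi.single (Function.update i r b s) 1) =
        Function.update e r (Pi.single b 1 : Fin (m + 1) → ℂ) := by
      ext s : 1
      by_cases hs : s = r
      · subst hs
        simp
      · simp [hs, he]
    have h4 := prod_single_one i j
    have h5 := prod_single_one (Function.update i r b) j
    have h6 : ∏ s, (Pi.single (i s) 1 : Fin (m + 1) → ℂ) (j s) =
        ∏ s, Function.update e r (Pi.single (i r) 1) s (j s) := by rw [← h2]
    have h7 : ∏ s, (Pi.single (Function.update i r b s) 1 : Fin (m + 1) → ℂ) (j s) =
        ∏ s, Function.update e r (Pi.single b 1) s (j s) := by rw [← h3]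
    rw [Pi.sub_apply, ← h4, ← h5, h6, h7, prod_update_eq, prod_update_eq, prod_update_eq,
      Pi.sub_apply, sub_mul]
  simp only [h1, Pi.sub_apply, star_sub, sub_mul, Finset.sum_sub_distrib, sum_star_single_mul,
    star_one, one_mul] at key
  exact key

theorem phase_mul_norm_sq_le_quad_piKron {B : ℝ} (hB : 1 ≤ B)
    (hmass : ∀ (t : ℝ) (v : Fin (m + 1) → ℂ) a,
      ‖v a‖ ^ 2 ≤ B * quad (symbol1D (mass (m + 1)) t) v)
    (θ : Fin d → ℝ) (r : Fin d) (V : (Fin d → Fin (m + 1)) → ℂ) :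
    (2 - 2 * Real.cos (θ r)) * ‖V fun _ => Fin.last m‖ ^ 2 ≤
      B ^ d * quad (piKron (tensorFactor m θ r)) V := by
  -- Conjugated, since the functional pairs with `star u`. In coordinate `r` it measures the jump
  -- between the two ends of an element.
  set c : ℂ := star (1 - Complex.exp (θ r * Complex.I)) with hc
  have hcn : ‖star c‖ ^ 2 = 2 - 2 * Real.cos (θ r) := by
    rw [hc, star_star, norm_one_sub_exp_mul_I_sq]
  set e : Fin d → Fin (m + 1) → ℂ := fun _ => Pi.single (Fin.last m) 1 with he
  have key := norm_sq_sum_prod_le_quad_piKron (fun s => posSemidef_tensorFactor (m := m) θ r s)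
    (Function.update e r (c • Pi.single (Fin.last m) 1)) (B := B) (by linarith)
    (fun s v => by
      rw [tensorFactor]
      split_ifs with h
      · subst h
        have h1 := norm_sq_sub_le_quad_stiff (θ s) v 0 (Fin.last m).succ
        have h2 := (sq_nonneg _).trans h1
        simp only [knotValues, Fin.cons_succ, Fin.cons_zero, norm_exp_mul_sub_self_sq] at h1
        simp only [Function.update_self, Pi.smul_apply, smul_eq_mul, star_mul', mul_assoc,
          ← Finset.mul_sum, sum_star_single_mul, star_one, one_mul]
        rw [norm_mul, mul_pow, hcn]
        nlinarith
      · rw [Function.update_of_ne h, he]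
        simp only [sum_star_single_mul, star_one, one_mul]
        exact hmass _ _ _) V
  rw [Fintype.card_fin] at key
  have h1 : ∀ j : Fin d → Fin (m + 1),
      ∏ s, Function.update e r (c • Pi.single (Fin.last m) 1) s (j s) =
      c * (Pi.single (fun _ => Fin.last m) 1 : (Fin d → Fin (m + 1)) → ℂ) j := by
    intro j
    rw [prod_update_eq, Pi.smul_apply, smul_eq_mul, mul_assoc, ← prod_single_one,
      ← Finset.mul_prod_erase _ _ (Finset.mem_univ r)]
  simp only [h1, star_mul', mul_assoc, ← Finset.mul_sum, sum_star_single_mul, star_one,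
    one_mul] at key
  rwa [norm_mul, mul_pow, hcn] at key

/-- Coordinates are changed one at a time. The `d` steps of length at most `√q` add up by the
triangle inequality. -/
theorem norm_sq_sub_le_of_update {κ : Type} [DecidableEq κ] (V : (Fin d → κ) → ℂ) {q : ℝ}
    (h : ∀ i r b, ‖V (Function.update i r b) - V i‖ ^ 2 ≤ q) (i j : Fin d → κ) :
    ‖V i - V j‖ ^ 2 ≤ d ^ 2 * q := by
  rcases Nat.eq_zero_or_pos d with rfl | hd
  · simp [Subsingleton.elim i j]
  have hq : 0 ≤ q := (sq_nonneg _).trans (h j ⟨0, hd⟩ (j ⟨0, hd⟩))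
  have hstep : ∀ i r b, ‖V (Function.update i r b) - V i‖ ≤ √q :=
    fun i r b => Real.le_sqrt_of_sq_le (h i r b)
  have hS : ∀ S : Finset (Fin d), ‖V (S.piecewise i j) - V j‖ ≤ S.card * √q := by
    intro S
    induction S using Finset.induction_on with
    | empty => simp
    | insert r S hr ih =>
      rw [Finset.piecewise_insert, Finset.card_insert_of_notMem hr]
      push_cast
      linarith [norm_sub_le_norm_sub_add_norm_sub (V (Function.update (S.piecewise i j) r (i r)))
        (V (S.piecewise i j)) (V j), hstep (S.piecewise i j) r (i r)]
  have h1 := hS Finset.univ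
  rw [Finset.piecewise_univ, Finset.card_univ, Fintype.card_fin] at h1
  calc ‖V i - V j‖ ^ 2 ≤ (d * √q) ^ 2 := pow_le_pow_left₀ (norm_nonneg _) h1 2
    _ = d ^ 2 * q := by rw [mul_pow, Real.sq_sqrt hq]

theorem exists_norm_tensorFactor_le (m : ℕ) : ∃ K : ℝ, 1 ≤ K ∧
    ∀ {d : ℕ} (θ : Fin d → ℝ) r s i j, ‖tensorFactor m θ r s i j‖ ≤ K := by
  have h : ∀ E : Fin (m + 2) → Fin (m + 2) → ℝ, ∃ K, ∀ i j, |E i j| ≤ K := fun E =>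
    ⟨∑ i, ∑ j, |E i j|, fun i j =>
      (Finset.single_le_sum (f := fun j => |E i j|) (fun _ _ => abs_nonneg _)
        (Finset.mem_univ j)).trans
      (Finset.single_le_sum (f := fun i => ∑ j, |E i j|)
        (fun _ _ => Finset.sum_nonneg fun _ _ => abs_nonneg _) (Finset.mem_univ i))⟩
  obtain ⟨K₁, h₁⟩ := h (stiff (m + 1))
  obtain ⟨K₂, h₂⟩ := h (mass (m + 1))
  refine ⟨max 1 (max (4 * K₁) (4 * K₂)), le_max_left _ _, fun θ r s i j => ?_⟩
  rw [tensorFactor]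
  split_ifs
  · exact (norm_symbol1D_apply_le h₁ _ _ _).trans
      ((le_max_left _ _).trans (le_max_right _ _))
  · exact (norm_symbol1D_apply_le h₂ _ _ _).trans
      ((le_max_right _ _).trans (le_max_right _ _))

theorem spectralClaims_fQ {k d : ℕ} (hk : 1 ≤ k) (hd : 1 ≤ d) : SpectralClaims k d (fQ k d) := by
  obtain ⟨m, rfl⟩ : ∃ m, k = m + 1 := ⟨k - 1, by omega⟩
  obtain ⟨B, hB, hmass⟩ := exists_norm_sq_le_quad_mass m
  obtain ⟨K, hK, hfac⟩ := exists_norm_tensorFactor_le m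
  have hBd : 0 < B ^ d := by positivity
  have hd' : (0 : ℝ) < d := by exact_mod_cast hd
  have hσ : 0 ≤ stiff (m + 1) 0 0 :=
    intervalIntegral.integral_nonneg zero_le_one fun t _ => mul_self_nonneg _
  -- `M` bounds the form of one factor at the vector of ones: `(m + 1)²` entries, each of norm at
  -- most `K`.
  set M : ℝ := ((m + 1 : ℕ) : ℝ) * (((m + 1 : ℕ) : ℝ) * K) with hM
  -- The distinguished index is the vertex node, last in every coordinate. In `B₁` the stiffness
  -- factor of each summand supplies `2 - 2 cos θ_r` and the other `d - 1` factors supply `M`. The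
  -- added 1 makes `B₁` positive from `hσ` alone.
  refine spectralClaims_of_quad _ (by simp) (fun θ => (posSemidef_fQ θ).1)
    (fun _ => Fin.last m) (M := (Fintype.card (Fin d → Fin (m + 1)) : ℝ) * (d * K ^ d))
    (B₁ := (stiff (m + 1) 0 0 + 1) * M ^ (d - 1)) (B₂ := B ^ d) (B₃ := d ^ 2 * B ^ d)
    (by positivity) (by positivity) (by positivity) ?_ ?_ ?_ ?_
  · intro θ
    refine (Complex.re_le_norm _).trans ((norm_sum_le_of_le _ (n := fun _ => d * K ^ d)
      fun i _ => ?_).trans (by simp))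
    rw [diag_apply, fQ_eq_sum_piKron, Matrix.sum_apply]
    refine (norm_sum_le_of_le _ (n := fun _ => K ^ d) fun r _ => ?_).trans (by simp)
    rw [piKron, of_apply, norm_prod]
    refine (Finset.prod_le_prod (fun _ _ => norm_nonneg _) fun s _ => hfac θ r s _ _).trans ?_
    simp
  · intro θ
    rw [quad_fQ, Finset.mul_sum]
    refine Finset.sum_le_sum fun r _ => (Complex.re_le_norm _).trans ?_
    have hs := (two_sub_two_cos_mem (θ r)).1
    rw [form_piKron_one, norm_prod, ← Finset.mul_prod_erase _ _ (Finset.mem_univ r)]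
    have h1 : ‖form (tensorFactor m θ r r) fun _ => 1‖ ≤
        (stiff (m + 1) 0 0 + 1) * (2 - 2 * Real.cos (θ r)) := by
      rw [tensorFactor, if_pos rfl, form_stiff_one, Complex.norm_real, Real.norm_eq_abs,
        abs_of_nonneg (mul_nonneg hs hσ)]
      linarith
    have h2 : ∏ s ∈ Finset.univ.erase r, ‖form (tensorFactor m θ r s) fun _ => 1‖ ≤
        M ^ (d - 1) := by
      refine (Finset.prod_le_prod (g := fun _ => M) (fun _ _ => norm_nonneg _)
        fun s _ => ?_).trans ?_
      · rw [form_eq_sum]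
        refine (norm_sum_le_of_le _ (n := fun _ => ((m + 1 : ℕ) : ℝ) * K) fun i _ => ?_).trans
          (by simp [hM])
        refine (norm_sum_le_of_le _ (n := fun _ => K) fun j _ => ?_).trans (by simp)
        rw [star_one, one_mul, mul_one]
        exact hfac θ r s i j
      · simp [Finset.card_erase_of_mem]
    calc _ ≤ (stiff (m + 1) 0 0 + 1) * (2 - 2 * Real.cos (θ r)) * M ^ (d - 1) :=
          mul_le_mul h1 h2 (Finset.prod_nonneg fun _ _ => norm_nonneg _) (by positivity)
      _ = _ := by ring
  · intro θ V
    rw [quad_fQ, Finset.sum_mul, Finset.mul_sum]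
    exact Finset.sum_le_sum fun r _ => phase_mul_norm_sq_le_quad_piKron hB hmass θ r V
  · intro θ V a
    rw [mul_assoc]
    exact norm_sq_sub_le_of_update V (fun i r b =>
      (norm_sq_update_sub_le_quad_piKron hB hmass θ r i b V).trans
        (mul_le_mul_of_nonneg_left (quad_piKron_le_quad_fQ θ V r) hBd.le)) _ _

end TensorSymbol

end FEMSymbol

theorem theorem3p4p1 :
    (∀ k d : ℕ, 1 ≤ k → 1 ≤ d → FEMSymbol.SpectralClaims k d (FEMSymbol.fQ k d)) ∧
    FEMSymbol.SpectralClaims 2 2 FEMSymbol.fP2 ∧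
    FEMSymbol.SpectralClaims 3 2 FEMSymbol.fP3 :=
  ⟨fun _ _ => FEMSymbol.spectralClaims_fQ, FEMSymbol.spectralClaims_fP2,
    FEMSymbol.spectralClaims_fP3⟩
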